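/- Fix $N\ge1$, $\beta\in(0,1)$ and real numbers $\alpha_1\le\dots\le\alpha_N$. For integers $a_1<\dots<a_N$, $x_1,x_2\in\mathbb Z$ and integers $t_1,t_2\ge1$, the correlation kernel of the noncolliding Bernoulli random walk with parameter $\beta$ started from $\vec a=(a_1,\dots,a_N)$ is $$ K^{\mathrm{Bernoulli}}_{\vec a;\beta}(t_1,x_1;t_2,x_2)=\mathbf 1_{x_1\ge x_2}\mathbf 1_{t_1>t_2}(-1)^{x_1-x_2+1}\binom{t_1-t_2}{x_1-x_2} +\frac{t_1!}{(t_2-1)!}\frac1{(2\pi i)^2}\int_{x_2-t_2+\frac12-i\infty}^{x_2-t_2+\frac12+i\infty}dz\oint dw\,\frac{(z-x_2+1)_{t_2-1}}{(w-x_1)_{t_1+1}}\,\frac1{w-z}\,\frac{\sin(\pi w)}{\sin(\pi z)}\Big(\frac{1-\beta}{\beta}\Big)^{w-z}\prod_{r=1}^N\frac{z-a_r}{w-a_r}, $$ where $(z)_k=z(z+1)\cdots(z+k-1)$, the $z$ contour is a vertical line traversed upwards, and the $w$ contour is a positively oriented circle, or a union of two circles, not meeting the $z$ line and encircling the integers $x_1-t_1,\dots,x_1$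 (hence all the $w$ poles of the integrand except $w=z$). For $M>0$, $\tau>0$, $\xi\in\mathbb R$ put $t(M;\tau)=\lfloor M\tau\rfloor$, $x(M;\tau,\xi)=\lfloor \beta M\tau+\xi\sqrt{\beta(1-\beta)}\sqrt M\rfloor$, and let $\vec a(M)$ be given by $a_i(M)=\lfloor\alpha_i\sqrt{\beta(1-\beta)}\sqrt M\rfloor+\#\{j<i:\alpha_j=\alpha_i\}$ (so that within a group of coinciding $\alpha_i$'s consecutive $a_i$'s differ by $1$). Then there is a nowhere vanishing real function $f_M(t,x)$ of $M$, $t$ and $x$ (a gauge transformation) such that for all $\tau_1,\tau_2>0$ and $\xi_1,\xi_2\in\mathbb R$, writing $t_k=t(M;\tau_k)$ and $x_k=x(M;\tau_k,\xi_k)$ for $k=1,2$, $$ \lim_{M\to+\infty}\frac{f_M(t_1,x_1)}{f_M(t_2,x_2)}\,\big(M\beta(1-\beta)\big)^{1/2}\,K^{\mathrm{Bernoulli}}_{\vec a(M);\beta}(t_1,x_1;t_2,x_2)=K^{\mathrm{DBM}}(\tau_1,\xi_1;\tau_2,\xi_2), $$ where $$ K^{\mathrm{DBM}}(\tau_1,\xi_1;\tau_2,\xi_2)=-\frac{\mathbf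 1_{\tau_1>\tau_2}}{\sqrt{2\pi(\tau_1-\tau_2)}}\exp\Big\{-\frac{(\xi_1-\xi_2)^2}{2(\tau_1-\tau_2)}\Big\} -\frac1{(2\pi i)^2\sqrt{\tau_1\tau_2}}\int_{c-i\infty}^{c+i\infty}dz\oint dw\,\frac1{w-z}\exp\Big\{\frac{\tau_1(z-\xi_2)^2-\tau_2(w-\xi_1)^2}{2\tau_1\tau_2}\Big\}\prod_{r=1}^N\frac{z-\alpha_r}{w-\alpha_r}. $$ Here the $w$ contour is any positively oriented circle encircling all the $\alpha_r$'s, and the $z$ contour is any vertical line $\operatorname{Re}z=c$ lying to the left of that circle (in particular $c<\alpha_1$). -/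

import Mathlib

open Real Complex Filter Topology MeasureTheory

noncomputable section

/-- The integral `∫ f(z) dz` over the vertical line `Re z = c`, traversed upwards. -/
def lineIntegral (c : ℝ) (f : ℂ → ℂ) : ℂ :=
  ∫ y : ℝ, f ((c : ℂ) + (y : ℂ) * I) * I

/-- The Pochhammer symbol `(z)_k = z (z + 1) ⋯ (z + k - 1)`. -/
def pochhammerC (z : ℂ) (k : ℕ) : ℂ :=
  (ascPochhammer ℂ k).eval z

/-- Integral over the positively oriented circle which crosses the real axis at `p - 1/4` and
`q + 1/4`, so that the integers it encircles are exactly `p, p + 1, …, q`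
(there is no such circle, and the contribution is zero, if `q < p`). -/
def circleAround (p q : ℤ) (f : ℂ → ℂ) : ℂ :=
  if p ≤ q then
    ∮ w in C((((p : ℝ) + (q : ℝ)) / 2 : ℝ), ((q : ℝ) - (p : ℝ)) / 2 + 1 / 4), f w
  else 0

/-- The `w` contour of the Bernoulli kernel: a circle, or a union of two circles, which encircle
the integers `x₁ - t₁, …, x₁`. The first circle lies to the left of the vertical line
`Re z = x₂ - t₂ + 1/2`, the second one to the right of it, so neither meets that line. -/
def bernoulliContour (t₁ : ℕ) (x₁ : ℤ) (t₂ : ℕ) (x₂ : ℤ) (f : ℂ → ℂ) : ℂ :=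
  circleAround (x₁ - t₁) (min x₁ (x₂ - t₂)) f
    + circleAround (max (x₁ - t₁) (x₂ - t₂ + 1)) x₁ f

/-- The correlation kernel `K(t₁, x₁; t₂, x₂)` (for `t₁, t₂ ≥ 1`) of the noncolliding Bernoulli
random walk with parameter `β ∈ (0, 1)` started from the configuration `a`. -/
def bernoulliKernel {N : ℕ} (β : ℝ) (a : Fin N → ℤ)
    (t₁ : ℕ) (x₁ : ℤ) (t₂ : ℕ) (x₂ : ℤ) : ℂ :=
  (if x₂ ≤ x₁ ∧ t₂ < t₁ then
      (-1 : ℂ) ^ (x₁ - x₂ + 1) * ((t₁ - t₂).choose (x₁ - x₂).toNat : ℂ)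
    else 0)
  + ((t₁.factorial : ℂ) / ((t₂ - 1).factorial : ℂ)) * (1 / (2 * π * I) ^ 2) *
      lineIntegral ((x₂ : ℝ) - (t₂ : ℝ) + 1 / 2) (fun z =>
        bernoulliContour t₁ x₁ t₂ x₂ (fun w =>
          pochhammerC (z - x₂ + 1) (t₂ - 1) / pochhammerC (w - x₁) (t₁ + 1)
            * (1 / (w - z))
            * (Complex.sin (π * w) / Complex.sin (π * z))
            * (((1 - β) / β : ℝ) : ℂ) ^ (w - z)
            * ∏ r : Fin N, (z - a r) / (w - a r)))

/-- The correlation kernel `K(τ₁, ξ₁; τ₂, ξ₂)` of the Dyson Brownian Motion started from `α`,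
written with the `z` contour `Re z = c` and with the positively oriented circle of center `w₀`
and radius `R` as the `w` contour. -/
def dysonKernel {N : ℕ} (α : Fin N → ℝ) (c : ℝ) (w₀ : ℂ) (R : ℝ)
    (τ₁ ξ₁ τ₂ ξ₂ : ℝ) : ℂ :=
  (if τ₂ < τ₁ then
      ((-(1 / √(2 * π * (τ₁ - τ₂)) * Real.exp (-((ξ₁ - ξ₂) ^ 2 / (2 * (τ₁ - τ₂))))) : ℝ) : ℂ)
    else 0)
  - 1 / ((2 * π * I) ^ 2 * ((√(τ₁ * τ₂) : ℝ) : ℂ)) *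
      lineIntegral c (fun z =>
        ∮ w in C(w₀, R),
          1 / (w - z)
            * Complex.exp (((τ₁ : ℂ) * (z - ξ₂) ^ 2 - (τ₂ : ℂ) * (w - ξ₁) ^ 2)
                / (2 * (τ₁ : ℂ) * (τ₂ : ℂ)))
            * ∏ r : Fin N, (z - α r) / (w - α r))

/-- The rescaled time `t = ⌊M τ⌋`. -/
def scaledTime (M τ : ℝ) : ℕ := ⌊M * τ⌋₊

/-- The rescaled position `x = ⌊β M τ + ξ √(β (1 - β)) √M⌋`. -/
def scaledPosition (β M τ ξ : ℝ) : ℤ := ⌊β * M * τ + ξ * √(β * (1 - β)) * √M⌋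

/-- The rescaled starting configuration `a i = ⌊α i √(β (1 - β)) √M⌋`; within a group of
coinciding `α i` the successive `a i` increase by `1`, so that the walk is well defined
(for all large `M`). -/
def scaledStart {N : ℕ} (β : ℝ) (α : Fin N → ℝ) (M : ℝ) (i : Fin N) : ℤ :=
  ⌊α i * √(β * (1 - β)) * √M⌋ + ((Finset.univ.filter fun j => j < i ∧ α j = α i).card : ℤ)

end

/-! Conjugation by `bernoulliGauge` and Euler's reflection formula turn the sines, Pochhammer
symbols and powers of the kernel into Gamma functions. The double integrand then splits as
`betaWeight` in z times `binomialWeight` in w, times the Cauchy factor and the rational product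
(`gauge_mul_integrand`). The w factor is a binomial probability continued to complex arguments; the
z factor is, in essence, the reciprocal of one.

In this form the analyticity is visible. `binomialWeight` is entire, so in w only the poles at z and
at the a_r survive, and the prescribed contour may be replaced by any circle around the a_r lying to
the right of the z line (`bernoulliContour_eq_circleIntegral`). `betaWeight` is holomorphic for 0 <
Re s < t, so the z line can be moved from its half-integer position, at distance of order M, to the
scale √M where the a_r live (`lineIntegral_contractedIntegrand_eq`).

Put S = √(Mβ(1-β)) and replace z, w by Sz, Sw. Counting powers leaves exactly one factor S for each
weight, and S times each weight converges: Stirling's formula in the Gaussian window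
(`tendsto_Gamma_add`) gives exp(-(w-ξ₁)²/(2τ₁)) and exp((z-ξ₂)²/(2τ₂)). The indicator term is again
a binomial weight, at the differences of times and positions, so its limit is the de Moivre-Laplace
theorem.

The limit must still be taken under the integrals. The circle is compact, so a locally uniform bound
suffices there. On the line the rational product grows like (1+y²)^N, and this is beaten by a decay
of the beta weight uniform in M (`exists_scaled_betaWeight_bound`), obtained by using the functional
equation of Γ a number of times proportional to M. -/

/-! ### Stirling's formula in the Gaussian window, by Laplace's method -/

/-- The Gamma integral after the substitution `x = exp v`. -/
theorem Gamma_eq_integral_cexp {z : ℂ} (hz : 0 < z.re) :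
    Complex.Gamma z = ∫ v : ℝ, Complex.exp (z * v - Real.exp v) := by
  have h := integral_image_eq_integral_abs_deriv_smul (s := Set.univ) (f := Real.exp)
    (f' := Real.exp) MeasurableSet.univ (fun x _ => (Real.hasDerivAt_exp x).hasDerivWithinAt)
    Real.exp_injective.injOn (fun x : ℝ => ((Real.exp (-x) : ℝ) : ℂ) * (x : ℂ) ^ (z - 1))
  rw [Set.image_univ, Real.range_exp, Measure.restrict_univ] at h
  rw [Complex.Gamma_eq_integral hz, Complex.GammaIntegral, h]
  refine integral_congr_ae (Eventually.of_forall fun v => ?_)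
  simp only
  rw [abs_of_pos (Real.exp_pos v), Complex.real_smul,
    Complex.cpow_def_of_ne_zero (by exact_mod_cast (Real.exp_pos v).ne'),
    ← Complex.ofReal_log (Real.exp_pos v).le, Real.log_exp]
  push_cast
  rw [← Complex.exp_add, ← Complex.exp_add]
  congr 1
  ring

/-- Laplace form of the Gamma integral, centered at the saddle point. -/
theorem Gamma_add_eq_integral_cexp {p : ℝ} (hp : 0 < p) {u : ℂ} (hu : 0 < p + u.re) :
    Complex.Gamma (p + u) * Complex.exp (p - (p + u - 1 / 2) * (Real.log p : ℝ))
      = ∫ s : ℝ, Complex.exp (u / (√p : ℝ) * s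
          - (p * (Real.exp (s / √p) - 1 - s / √p) : ℝ)) := by
  have hsp : 0 < √p := Real.sqrt_pos.2 hp
  have h1 : Complex.Gamma (p + u)
      = ∫ v : ℝ, Complex.exp ((p + u) * v - Real.exp v) :=
    Gamma_eq_integral_cexp (by simpa using hu)
  -- The phase p v - exp v has its critical point at v = log p, with second derivative -p; hence the
  -- substitution v = log p + s/√p.
  have h2 := integral_add_left_eq_self (μ := (volume : Measure ℝ))
    (fun v : ℝ => Complex.exp ((p + u) * v - Real.exp v)) (Real.log p)
  have h3 := Measure.integral_comp_div
    (fun v : ℝ => Complex.exp ((p + u) * (Real.log p + v : ℝ) - Real.exp (Real.log p + v))) (√p)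
  rw [h2, ← h1, abs_of_pos hsp, Complex.real_smul] at h3
  have h4 : ((√p : ℝ) : ℂ) = Complex.exp (1 / 2 * (Real.log p : ℝ)) := by
    rw [Real.sqrt_eq_rpow, Real.rpow_def_of_pos hp]
    push_cast
    congr 1
    ring
  calc _ = (((√p : ℝ) : ℂ) * Complex.Gamma (p + u)) *
        Complex.exp (p - (p + u) * (Real.log p : ℝ)) := by
        rw [h4, mul_right_comm, mul_comm (Complex.Gamma _), ← Complex.exp_add]
        congr 2
        ring
    _ = _ := by
        rw [← h3, ← integral_mul_const]
        refine integral_congr_ae (Eventually.of_forall fun s => ?_)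
        simp only
        rw [← Complex.exp_add, Real.exp_add, Real.exp_log hp]
        congr 1
        push_cast
        ring

/-- Convexity supplies the majorant for Laplace's method: the graph of exp lies above its tangents.
The slope k/2 can be made as large as desired, uniformly in p ≥ k². -/
theorem linear_le_exp_sub_one_sub {p k : ℝ} (hk : 0 < k) (hp : k ≤ √p) (s : ℝ) :
    k / 2 * |s| - k ^ 2 ≤ p * (Real.exp (s / √p) - 1 - s / √p) := by
  have hq : 0 < √p := hk.trans_le hp
  have hpp : p = √p ^ 2 := (Real.sq_sqrt (Real.sqrt_pos.1 hq).le).symm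
  set q := √p
  rw [hpp]
  set v := s / q
  have hs : s = q * v := by simp only [v]; field_simp
  set b := k / q
  have hkb : k = q * b := by simp only [b]; field_simp
  have hb0 : 0 < b := div_pos hk hq
  have hb1 : b ≤ 1 := (div_le_one hq).2 hp
  rw [hs, hkb, abs_mul, abs_of_pos hq]
  suffices b / 2 * |v| - b ^ 2 ≤ Real.exp v - 1 - v by
    nlinarith [mul_le_mul_of_nonneg_left this (sq_nonneg q)]
  -- The tangent at b serves v ≥ 0, the one at -b serves v ≤ 0. The negative side forces the factor
  -- 1/2, since 1 - exp(-b) ≥ b/2 on (0, 1] whereas exp b - 1 ≥ b.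
  rcases le_total 0 v with hv | hv
  · rw [abs_of_nonneg hv]
    have h1 : Real.exp b * (1 + (v - b)) ≤ Real.exp v := by
      have := mul_le_mul_of_nonneg_left (Real.add_one_le_exp (v - b)) (Real.exp_pos b).le
      rw [← Real.exp_add] at this
      rw [add_comm 1]
      simpa using this
    have h2 := Real.add_one_le_exp b
    nlinarith [mul_nonneg hv hb0.le, mul_nonneg (sub_nonneg.2 h2) hv,
      mul_nonneg (sub_nonneg.2 h2) (sub_nonneg.2 hb1)]
  · rw [abs_of_nonpos hv]
    have h1 : Real.exp (-b) * (1 + (v + b)) ≤ Real.exp v := by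
      have := mul_le_mul_of_nonneg_left (Real.add_one_le_exp (v + b)) (Real.exp_pos (-b)).le
      rw [← Real.exp_add] at this
      rw [add_comm 1]
      simpa using this
    have h2 := Real.add_one_le_exp (-b)
    have h3 : Real.exp (-b) ≤ 1 - b / 2 := by
      have h4 := Real.add_one_le_exp b
      have h5 : Real.exp (-b) * Real.exp b = 1 := by rw [← Real.exp_add]; simp
      nlinarith [Real.exp_pos (-b)]
    nlinarith [mul_nonneg (neg_nonneg.2 hv) hb0.le, mul_nonneg (sub_nonneg.2 h3) (neg_nonneg.2 hv),
      mul_nonneg (sub_nonneg.2 h2) hb0.le]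

theorem tendsto_mul_exp_sub_one_sub {ι : Type*} {l : Filter ι} {p : ι → ℝ}
    (hp : Tendsto p l atTop) (s : ℝ) :
    Tendsto (fun i => p i * (Real.exp (s / √(p i)) - 1 - s / √(p i))) l (𝓝 (s ^ 2 / 2)) := by
  have hq : Tendsto (fun i => √(p i)) l atTop := Real.tendsto_sqrt_atTop.comp hp
  have hv : Tendsto (fun i => s / √(p i)) l (𝓝 0) := hq.const_div_atTop s
  rw [← tendsto_sub_nhds_zero_iff]
  have hbound : Tendsto (fun i => s ^ 2 * (|s / √(p i)| * Real.exp |s / √(p i)|)) l (𝓝 0) := by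
    have h := hv.abs
    have h' := (h.mul ((Real.continuous_exp.tendsto _).comp h)).const_mul (s ^ 2)
    simpa using h'
  refine squeeze_zero_norm' ?_ hbound
  filter_upwards [hp.eventually_gt_atTop 0] with i hi
  have h := Complex.norm_exp_sub_sum_le_norm_mul_exp ((s / √(p i) : ℝ) : ℂ) 3
  have hsq : √(p i) ^ 2 = p i := Real.sq_sqrt hi.le
  have hsp : 0 < √(p i) := Real.sqrt_pos.2 hi
  rw [Finset.sum_range_succ, Finset.sum_range_succ, Finset.sum_range_one] at h
  rw [Complex.norm_real, Real.norm_eq_abs] at h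
  have e : Complex.exp ((s / √(p i) : ℝ) : ℂ) - (((s / √(p i) : ℝ) : ℂ) ^ 0 / ((Nat.factorial 0 : ℕ) : ℂ)
      + ((s / √(p i) : ℝ) : ℂ) ^ 1 / ((Nat.factorial 1 : ℕ) : ℂ)
      + ((s / √(p i) : ℝ) : ℂ) ^ 2 / ((Nat.factorial 2 : ℕ) : ℂ))
      = ((Real.exp (s / √(p i)) - 1 - s / √(p i) - (s / √(p i)) ^ 2 / 2 : ℝ) : ℂ) := by
    push_cast
    simp
    ring
  rw [e, Complex.norm_real] at h
  have e2 : p i * (Real.exp (s / √(p i)) - 1 - s / √(p i)) - s ^ 2 / 2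
      = p i * (Real.exp (s / √(p i)) - 1 - s / √(p i) - (s / √(p i)) ^ 2 / 2) := by
    rw [div_pow, hsq]
    field_simp
  rw [e2, norm_mul, Real.norm_of_nonneg hi.le]
  calc _ ≤ p i * (|s / √(p i)| ^ 3 * Real.exp |s / √(p i)|) := by gcongr
    _ = (p i * |s / √(p i)| ^ 2) * (|s / √(p i)| * Real.exp |s / √(p i)|) := by ring
    _ = _ := by
      rw [sq_abs, div_pow, hsq]
      congr 1
      field_simp

theorem integral_cexp_mul_sub_sq_div_two (ζ : ℂ) :
    ∫ s : ℝ, Complex.exp (ζ * s - (s ^ 2 / 2 : ℝ))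
      = (√(2 * π) : ℝ) * Complex.exp (ζ ^ 2 / 2) := by
  have h := integral_cexp_quadratic (b := -(1 / 2)) (by simp) ζ 0
  have e : ∀ s : ℝ, ζ * s - (s ^ 2 / 2 : ℝ) = -(1 / 2) * (s : ℂ) ^ 2 + ζ * s + 0 := by
    intro s; push_cast; ring
  simp_rw [e, h]
  congr 1
  · rw [Real.sqrt_eq_rpow, Complex.ofReal_cpow (by positivity)]
    push_cast
    congr 1
    ring
  · congr 1
    ring

theorem integrable_exp_neg_abs_real : Integrable (fun s : ℝ => Real.exp (-|s|)) := by
  rw [← integrableOn_univ, ← Set.Iic_union_Ioi (a := (0 : ℝ))]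
  refine IntegrableOn.union ?_ ?_
  · refine (integrableOn_exp_Iic 0).congr_fun (fun s hs => ?_) measurableSet_Iic
    simp [abs_of_nonpos (Set.mem_Iic.1 hs)]
  · refine (exp_neg_integrableOn_Ioi 0 one_pos).congr_fun (fun s hs => ?_) measurableSet_Ioi
    simp [abs_of_pos (Set.mem_Ioi.1 hs)]

/-- Stirling's formula in the Gaussian window `u = O(√p)`. -/
theorem tendsto_Gamma_add {ι : Type*} {l : Filter ι} [l.IsCountablyGenerated] {p : ι → ℝ}
    {u : ι → ℂ} {ζ : ℂ} (hp : Tendsto p l atTop)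
    (hu : Tendsto (fun i => u i / (√(p i) : ℝ)) l (𝓝 ζ)) :
    Tendsto (fun i => Complex.Gamma (p i + u i)
        * Complex.exp (p i - (p i + u i - 1 / 2) * (Real.log (p i) : ℝ))) l
      (𝓝 ((√(2 * π) : ℝ) * Complex.exp (ζ ^ 2 / 2))) := by
  have hq : Tendsto (fun i => √(p i)) l atTop := Real.tendsto_sqrt_atTop.comp hp
  set C := ‖ζ‖ + 1
  have hC : 0 < C := by positivity
  have hev : ∀ᶠ i in l, ‖u i / (√(p i) : ℝ)‖ ≤ C :=
    (hu.norm.eventually (eventually_lt_nhds (lt_add_one ‖ζ‖))).mono fun _ h => h.le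
  rw [← integral_cexp_mul_sub_sq_div_two]
  have key : Tendsto (fun i => ∫ s : ℝ, Complex.exp (u i / (√(p i) : ℝ) * s
          - (p i * (Real.exp (s / √(p i)) - 1 - s / √(p i)) : ℝ))) l
      (𝓝 (∫ s : ℝ, Complex.exp (ζ * s - (s ^ 2 / 2 : ℝ)))) := by
    -- With k = 2(C+1) the phase loses at least (C+1)|s| - k², while the linear term gains at most
    -- C|s|; the net decay is exp(-|s|).
    refine tendsto_integral_filter_of_dominated_convergence
      (fun s => Real.exp ((2 * (C + 1)) ^ 2) * Real.exp (-|s|)) ?_ ?_ ?_ ?_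
    · refine Eventually.of_forall fun i => Continuous.aestronglyMeasurable ?_
      fun_prop
    · filter_upwards [hev, hq.eventually_ge_atTop (2 * (C + 1))] with i h1 h2
      refine Eventually.of_forall fun s => ?_
      rw [Complex.norm_exp, ← Real.exp_add]
      apply Real.exp_le_exp.2
      have h3 := linear_le_exp_sub_one_sub (by positivity) h2 s
      have h4 : (u i / (√(p i) : ℝ) * s).re ≤ C * |s| := by
        refine (Complex.re_le_norm _).trans ?_
        rw [norm_mul, Complex.norm_real, Real.norm_eq_abs]
        gcongr
      rw [Complex.sub_re, Complex.ofReal_re]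
      linarith
    · exact integrable_exp_neg_abs_real.const_mul _
    · refine Eventually.of_forall fun s => ?_
      refine (Complex.continuous_exp.tendsto _).comp ?_
      refine (hu.mul_const _).sub ?_
      exact (Complex.continuous_ofReal.tendsto _).comp (tendsto_mul_exp_sub_one_sub hp s)
  refine key.congr' ?_
  -- Once √p > C, the bound |u| ≤ C√p < p keeps p + u in the right half-plane, where the Gamma
  -- integral converges.
  filter_upwards [hev, hq.eventually_gt_atTop C, hp.eventually_gt_atTop 0] with i h1 h2 h3
  refine (Gamma_add_eq_integral_cexp h3 ?_).symm
  have hs : 0 < √(p i) := Real.sqrt_pos.2 h3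
  rw [norm_div, Complex.norm_real, Real.norm_of_nonneg hs.le, div_le_iff₀ hs] at h1
  have h5 := (abs_le.1 (Complex.abs_re_le_norm (u i))).1
  nlinarith [Real.sq_sqrt h3.le]

/-! ### Binomial and Beta weights and their local limits -/

noncomputable section

/-- The binomial probability `t.choose s * β ^ s * (1 - β) ^ (t - s)`, for complex `t` and `s`. -/
def binomialWeight (β : ℝ) (t s : ℂ) : ℂ :=
  Complex.Gamma (t + 1) / (Complex.Gamma (s + 1) * Complex.Gamma (t - s + 1))
    * Complex.exp (s * (Real.log β : ℝ) + (t - s) * (Real.log (1 - β) : ℝ))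

/-- The Beta function `B(s, t - s)` divided by `β ^ s * (1 - β) ^ (t - s)`. -/
def betaWeight (β : ℝ) (t s : ℂ) : ℂ :=
  Complex.Gamma s * Complex.Gamma (t - s) / Complex.Gamma t
    * Complex.exp (-(s * (Real.log β : ℝ) + (t - s) * (Real.log (1 - β) : ℝ)))

end

theorem sq_div_two_mul_mul_one_sub {β : ℝ} (hβ₀ : 0 < β) (hβ₁ : β < 1) (κ : ℂ) :
    κ ^ 2 / (2 * ((β * (1 - β) : ℝ) : ℂ))
      = κ ^ 2 / (2 * β) + (-κ) ^ 2 / (2 * ((1 - β : ℝ) : ℂ)) := by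
  have h1 : (β : ℂ) ≠ 0 := by exact_mod_cast hβ₀.ne'
  have h2 : ((1 - β : ℝ) : ℂ) ≠ 0 := by exact_mod_cast (sub_pos.2 hβ₁).ne'
  push_cast at h2 ⊢
  field_simp
  ring

theorem sqrt_mul_sqrt_eq_cexp {β m : ℝ} (hβ₀ : 0 < β) (hβ₁ : β < 1) (hm : 0 < m) :
    ((√m * √(β * (1 - β)) : ℝ) : ℂ) = Complex.exp (1 / 2 * ((Real.log m : ℝ)
      + (Real.log β : ℝ) + (Real.log (1 - β) : ℝ))) := by
  have h1β : 0 < 1 - β := sub_pos.2 hβ₁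
  rw [← Real.sqrt_mul hm.le, Real.sqrt_eq_rpow, Real.rpow_def_of_pos (by positivity),
    Real.log_mul hm.ne' (by positivity), Real.log_mul hβ₀.ne' h1β.ne']
  push_cast
  congr 1
  ring

section
variable {ι : Type*} {l : Filter ι} [l.IsCountablyGenerated] {β : ℝ} {m : ι → ℝ} {t s : ι → ℂ}
  {κ : ℂ}

/-- A bounded shift δ is invisible at scale √m. One statement thus covers the arguments s + 1 of the
binomial weight and s of the Beta weight. -/
theorem tendsto_Gamma_of_mul (hβ : 0 < β) (hm : Tendsto m l atTop)
    (hs : Tendsto (fun i => (s i - (β * m i : ℝ)) / (√(m i) : ℝ)) l (𝓝 κ)) (δ : ℂ) :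
    Tendsto (fun i => Complex.Gamma (s i + δ) * Complex.exp ((β * m i : ℝ)
        - (s i + δ - 1 / 2) * ((Real.log β : ℝ) + (Real.log (m i) : ℝ)))) l
      (𝓝 ((√(2 * π) : ℝ) * Complex.exp (κ ^ 2 / (2 * β)))) := by
  have hq : Tendsto (fun i => √(m i)) l atTop := Real.tendsto_sqrt_atTop.comp hm
  have hinv : Tendsto (fun i => δ / ((√(m i) : ℝ) : ℂ)) l (𝓝 0) := by
    have := (Complex.continuous_ofReal.tendsto _).comp hq.inv_tendsto_atTop
    simpa [div_eq_mul_inv] using this.const_mul δ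
  have hβc : ((√β : ℝ) : ℂ) ^ 2 = β := by rw [← Complex.ofReal_pow, Real.sq_sqrt hβ.le]
  have h := tendsto_Gamma_add (p := fun i => β * m i) (u := fun i => s i + δ - (β * m i : ℝ))
    (ζ := κ / (√β : ℝ)) (hm.const_mul_atTop hβ) (by
      have := (hs.add hinv).div_const ((√β : ℝ) : ℂ)
      rw [add_zero] at this
      refine this.congr fun i => ?_
      rw [Real.sqrt_mul hβ.le, Complex.ofReal_mul (√β), ← add_div, div_div, mul_comm ((√β : ℝ) : ℂ)]
      congr 1
      ring)
  have e : (κ / ((√β : ℝ) : ℂ)) ^ 2 / 2 = κ ^ 2 / (2 * β) := by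
    rw [div_pow, hβc, div_div, mul_comm (β : ℂ)]
  rw [e] at h
  refine h.congr' ?_
  filter_upwards [hm.eventually_gt_atTop 0] with i hi
  rw [Real.log_mul hβ.ne' hi.ne']
  push_cast
  congr 2
  · ring
  · ring

/-- This is de Moivre-Laplace for complex s: three Stirling formulas with leading parts m, βm and
(1-β)m, whose exponential prefactors cancel and whose Gaussian exponents combine by
`sq_div_two_mul_mul_one_sub`. An arbitrary filter is allowed so that M and w can later tend to their
limits jointly. -/
theorem tendsto_binomialWeight (hβ₀ : 0 < β) (hβ₁ : β < 1) (hm : Tendsto m l atTop)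
    (ht : Tendsto (fun i => (t i - m i) / (√(m i) : ℝ)) l (𝓝 0))
    (hs : Tendsto (fun i => (s i - (β * m i : ℝ)) / (√(m i) : ℝ)) l (𝓝 κ)) :
    Tendsto (fun i => ((√(m i) * √(β * (1 - β)) : ℝ) : ℂ) * binomialWeight β (t i) (s i)) l
      (𝓝 ((√(2 * π) : ℝ)⁻¹ * Complex.exp (-(κ ^ 2 / (2 * (β * (1 - β) : ℝ)))))) := by
  have h1β : 0 < 1 - β := sub_pos.2 hβ₁
  have hts : Tendsto (fun i => (t i - s i - ((1 - β) * m i : ℝ)) / (√(m i) : ℝ)) l (𝓝 (-κ)) := by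
    have := ht.sub hs
    rw [zero_sub] at this
    refine this.congr fun i => ?_
    push_cast
    ring
  have hA := tendsto_Gamma_of_mul (β := 1) one_pos hm (by simpa using ht) 1
  have hB := tendsto_Gamma_of_mul hβ₀ hm hs 1
  have hC := tendsto_Gamma_of_mul h1β hm hts 1
  have hπ : ((√(2 * π) : ℝ) : ℂ) ≠ 0 := by
    exact_mod_cast (Real.sqrt_pos.2 (by positivity)).ne'
  have hlim := hA.div (hB.mul hC) (mul_ne_zero (mul_ne_zero hπ (Complex.exp_ne_zero _))
    (mul_ne_zero hπ (Complex.exp_ne_zero _)))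
  have e : ((√(2 * π) : ℝ) * Complex.exp (0 ^ 2 / (2 * (1 : ℝ)))) /
      ((√(2 * π) : ℝ) * Complex.exp (κ ^ 2 / (2 * β)) *
        ((√(2 * π) : ℝ) * Complex.exp ((-κ) ^ 2 / (2 * (1 - β : ℝ)))))
      = ((√(2 * π) : ℝ)⁻¹ : ℝ) * Complex.exp (-(κ ^ 2 / (2 * (β * (1 - β) : ℝ)))) := by
    rw [sq_div_two_mul_mul_one_sub hβ₀ hβ₁, Complex.exp_neg, Complex.exp_add]
    rw [Complex.ofReal_inv]
    have := Complex.exp_ne_zero (κ ^ 2 / (2 * β))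
    have := Complex.exp_ne_zero ((-κ) ^ 2 / (2 * ((1 - β : ℝ) : ℂ)))
    simp only [ne_eq, OfNat.ofNat_ne_zero, not_false_eq_true, zero_pow, zero_div, Complex.exp_zero,
      mul_one]
    field_simp
  rw [e] at hlim
  refine hlim.congr' ?_
  filter_upwards [hm.eventually_gt_atTop 0] with i hi
  rw [sqrt_mul_sqrt_eq_cexp hβ₀ hβ₁ hi, binomialWeight, Pi.div_apply, Real.log_one, mul_mul_mul_comm, ← Complex.exp_add, mul_div_mul_comm,
    ← Complex.exp_sub, mul_left_comm, ← Complex.exp_add]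
  push_cast
  congr 2
  ring

theorem tendsto_betaWeight (hβ₀ : 0 < β) (hβ₁ : β < 1) (hm : Tendsto m l atTop)
    (ht : Tendsto (fun i => (t i - m i) / (√(m i) : ℝ)) l (𝓝 0))
    (hs : Tendsto (fun i => (s i - (β * m i : ℝ)) / (√(m i) : ℝ)) l (𝓝 κ)) :
    Tendsto (fun i => ((√(m i) * √(β * (1 - β)) : ℝ) : ℂ) * betaWeight β (t i) (s i)) l
      (𝓝 ((√(2 * π) : ℝ) * Complex.exp (κ ^ 2 / (2 * (β * (1 - β) : ℝ))))) := by
  have h1β : 0 < 1 - β := sub_pos.2 hβ₁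
  have hts : Tendsto (fun i => (t i - s i - ((1 - β) * m i : ℝ)) / (√(m i) : ℝ)) l (𝓝 (-κ)) := by
    have := ht.sub hs
    rw [zero_sub] at this
    refine this.congr fun i => ?_
    push_cast
    ring
  have hA := tendsto_Gamma_of_mul (β := 1) one_pos hm (by simpa using ht) 0
  have hB := tendsto_Gamma_of_mul hβ₀ hm hs 0
  have hC := tendsto_Gamma_of_mul h1β hm hts 0
  have hπ : ((√(2 * π) : ℝ) : ℂ) ≠ 0 := by
    exact_mod_cast (Real.sqrt_pos.2 (by positivity)).ne'
  have hlim := (hB.mul hC).div hA (mul_ne_zero hπ (Complex.exp_ne_zero _))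
  have e : ((√(2 * π) : ℝ) * Complex.exp (κ ^ 2 / (2 * β)) *
        ((√(2 * π) : ℝ) * Complex.exp ((-κ) ^ 2 / (2 * (1 - β : ℝ))))) /
        ((√(2 * π) : ℝ) * Complex.exp (0 ^ 2 / (2 * (1 : ℝ))))
      = ((√(2 * π) : ℝ) : ℂ) * Complex.exp (κ ^ 2 / (2 * (β * (1 - β) : ℝ))) := by
    rw [sq_div_two_mul_mul_one_sub hβ₀ hβ₁, Complex.exp_add]
    simp only [ne_eq, OfNat.ofNat_ne_zero, not_false_eq_true, zero_pow, zero_div, Complex.exp_zero,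
      mul_one]
    field_simp
  rw [e] at hlim
  refine hlim.congr' ?_
  filter_upwards [hm.eventually_gt_atTop 0] with i hi
  simp only [add_zero, Pi.div_apply]
  rw [sqrt_mul_sqrt_eq_cexp hβ₀ hβ₁ hi, betaWeight, Real.log_one, mul_mul_mul_comm, ← Complex.exp_add, mul_div_mul_comm,
    ← Complex.exp_sub, mul_left_comm, ← Complex.exp_add]
  push_cast
  congr 2
  ring

end

/-! ### The weights at the rescaled times and positions -/

section
variable {β τ ξ B : ℝ} {t x : ℝ → ℝ}

theorem tendsto_div_sqrt_of_eventually_le {g : ℝ → ℝ} (hτ : 0 < τ)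
    (h : ∀ᶠ M in atTop, |g M| ≤ B) :
    Tendsto (fun M => ((g M : ℝ) : ℂ) / (√(M * τ) : ℝ)) atTop (𝓝 0) := by
  have hq : Tendsto (fun M : ℝ => √(M * τ)) atTop atTop :=
    Real.tendsto_sqrt_atTop.comp (tendsto_id.atTop_mul_const hτ)
  refine squeeze_zero_norm' ?_ (hq.const_div_atTop B)
  filter_upwards [h] with M hM
  rw [norm_div, Complex.norm_real, Complex.norm_real, Real.norm_eq_abs,
    Real.norm_of_nonneg (Real.sqrt_nonneg _)]
  gcongr

theorem sqrt_mul_mul_one_sub (hβ₀ : 0 < β) (hβ₁ : β < 1) (M : ℝ) :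
    √(M * β * (1 - β)) = √M * √(β * (1 - β)) := by
  rw [mul_assoc, Real.sqrt_mul' _ (mul_nonneg hβ₀.le (sub_pos.2 hβ₁).le)]

theorem tendsto_scaled_position (hβ₀ : 0 < β) (hβ₁ : β < 1) (hτ : 0 < τ)
    (hx : ∀ᶠ M in atTop, |x M - (β * M * τ + ξ * √(β * (1 - β)) * √M)| ≤ B) (w : ℂ) :
    Tendsto (fun q : ℝ × ℂ => (((x q.1 : ℝ) : ℂ) - (√(q.1 * β * (1 - β)) : ℝ) * q.2
        - (β * (q.1 * τ) : ℝ)) / (√(q.1 * τ) : ℝ)) (atTop ×ˢ 𝓝 w)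
      (𝓝 ((√(β * (1 - β)) : ℝ) / (√τ : ℝ) * (ξ - w))) := by
  have h1 := (tendsto_div_sqrt_of_eventually_le hτ hx).comp (tendsto_fst (f := atTop) (g := 𝓝 w))
  have h2 : Tendsto (fun q : ℝ × ℂ => ((√(β * (1 - β)) : ℝ) : ℂ) / (√τ : ℝ) * (ξ - q.2))
      (atTop ×ˢ 𝓝 w) (𝓝 ((√(β * (1 - β)) : ℝ) / (√τ : ℝ) * (ξ - w))) :=
    (tendsto_snd.const_sub _).const_mul _
  have h3 := h1.add h2
  rw [zero_add] at h3
  refine h3.congr' ?_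
  filter_upwards [tendsto_fst.eventually (eventually_gt_atTop (0 : ℝ))] with q hq
  have hs : ((√q.1 : ℝ) : ℂ) ≠ 0 := by exact_mod_cast (Real.sqrt_pos.2 hq).ne'
  have ht : ((√τ : ℝ) : ℂ) ≠ 0 := by exact_mod_cast (Real.sqrt_pos.2 hτ).ne'
  simp only [Function.comp_apply]
  rw [sqrt_mul_mul_one_sub hβ₀ hβ₁, Real.sqrt_mul hq.le]
  push_cast
  field_simp
  ring

theorem scaled_exponent_eq (hβ₀ : 0 < β) (hβ₁ : β < 1) (hτ : 0 < τ) (w : ℂ) :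
    ((√(β * (1 - β)) : ℝ) / (√τ : ℝ) * (ξ - w)) ^ 2 / (2 * ((β * (1 - β) : ℝ) : ℂ))
      = (w - ξ) ^ 2 / (2 * τ) := by
  have hσ : 0 < β * (1 - β) := mul_pos hβ₀ (sub_pos.2 hβ₁)
  have h1 : ((√(β * (1 - β)) : ℝ) : ℂ) ^ 2 = ((β * (1 - β) : ℝ) : ℂ) := by
    rw [← Complex.ofReal_pow, Real.sq_sqrt hσ.le]
  have h2 : ((√τ : ℝ) : ℂ) ^ 2 = τ := by rw [← Complex.ofReal_pow, Real.sq_sqrt hτ.le]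
  have h3 : ((β * (1 - β) : ℝ) : ℂ) ≠ 0 := by exact_mod_cast hσ.ne'
  have h4 : (τ : ℂ) ≠ 0 := by exact_mod_cast hτ.ne'
  rw [mul_pow, div_pow, h1, h2]
  field_simp
  ring

/-- The limit is joint in M and the point, because a bound uniform on the w circle is extracted from
it by compactness. For the Beta weight a pointwise limit is enough, its domination being proved
separately. -/
theorem tendsto_scaled_binomialWeight (hβ₀ : 0 < β) (hβ₁ : β < 1) (hτ : 0 < τ)
    (ht : ∀ᶠ M in atTop, |t M - M * τ| ≤ B)
    (hx : ∀ᶠ M in atTop, |x M - (β * M * τ + ξ * √(β * (1 - β)) * √M)| ≤ B) (w : ℂ) :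
    Tendsto (fun q : ℝ × ℂ => ((√(q.1 * β * (1 - β)) : ℝ) : ℂ)
        * binomialWeight β (t q.1) (x q.1 - (√(q.1 * β * (1 - β)) : ℝ) * q.2)) (atTop ×ˢ 𝓝 w)
      (𝓝 ((√(2 * π * τ) : ℝ)⁻¹ * Complex.exp (-((w - ξ) ^ 2 / (2 * τ))))) := by
  have h := tendsto_binomialWeight (m := fun q : ℝ × ℂ => q.1 * τ) (l := atTop ×ˢ 𝓝 w)
    (t := fun q => ((t q.1 : ℝ) : ℂ)) hβ₀ hβ₁
    ((tendsto_id.atTop_mul_const hτ).comp tendsto_fst)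
    (by
      refine ((tendsto_div_sqrt_of_eventually_le hτ ht).comp
        (tendsto_fst (f := atTop) (g := 𝓝 w))).congr fun q => ?_
      simp) (tendsto_scaled_position hβ₀ hβ₁ hτ hx w)
  rw [scaled_exponent_eq hβ₀ hβ₁ hτ] at h
  have hτc : ((√τ : ℝ) : ℂ) ≠ 0 := by exact_mod_cast (Real.sqrt_pos.2 hτ).ne'
  have h' := h.const_mul ((√τ : ℝ) : ℂ)⁻¹
  have e : ((√τ : ℝ) : ℂ)⁻¹ * ((√(2 * π) : ℝ)⁻¹ * Complex.exp (-((w - ξ) ^ 2 / (2 * τ))))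
      = (√(2 * π * τ) : ℝ)⁻¹ * Complex.exp (-((w - ξ) ^ 2 / (2 * τ))) := by
    rw [Real.sqrt_mul' _ hτ.le]
    push_cast
    rw [mul_inv]
    ring
  rw [e] at h'
  refine h'.congr fun q => ?_
  rw [sqrt_mul_mul_one_sub hβ₀ hβ₁, Real.sqrt_mul' _ hτ.le]
  push_cast
  field_simp

theorem tendsto_scaled_betaWeight (hβ₀ : 0 < β) (hβ₁ : β < 1) (hτ : 0 < τ)
    (ht : ∀ᶠ M in atTop, |t M - M * τ| ≤ B)
    (hx : ∀ᶠ M in atTop, |x M - (β * M * τ + ξ * √(β * (1 - β)) * √M)| ≤ B) (w : ℂ) :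
    Tendsto (fun M : ℝ => ((√(M * β * (1 - β)) : ℝ) : ℂ)
        * betaWeight β (t M) (x M - (√(M * β * (1 - β)) : ℝ) * w)) atTop
      (𝓝 ((√(2 * π) / √τ : ℝ) * Complex.exp ((w - ξ) ^ 2 / (2 * τ)))) := by
  have hx' : Tendsto (fun M : ℝ => (((x M : ℝ) : ℂ) - (√(M * β * (1 - β)) : ℝ) * w
      - (β * (M * τ) : ℝ)) / (√(M * τ) : ℝ)) atTop
      (𝓝 ((√(β * (1 - β)) : ℝ) / (√τ : ℝ) * (ξ - w))) :=
    (tendsto_scaled_position hβ₀ hβ₁ hτ hx w).comp (f := fun M : ℝ => (M, w))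
      (tendsto_id.prodMk tendsto_const_nhds)
  have h := tendsto_betaWeight (m := fun M : ℝ => M * τ) (l := atTop)
    (t := fun M => ((t M : ℝ) : ℂ)) hβ₀ hβ₁ (tendsto_id.atTop_mul_const hτ)
    (by
      refine (tendsto_div_sqrt_of_eventually_le hτ ht).congr fun M => ?_
      simp) hx'
  rw [scaled_exponent_eq hβ₀ hβ₁ hτ] at h
  have hτc : ((√τ : ℝ) : ℂ) ≠ 0 := by exact_mod_cast (Real.sqrt_pos.2 hτ).ne'
  have h' := h.const_mul ((√τ : ℝ) : ℂ)⁻¹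
  have e : ((√τ : ℝ) : ℂ)⁻¹ * ((√(2 * π) : ℝ) * Complex.exp ((w - ξ) ^ 2 / (2 * τ)))
      = (√(2 * π) / √τ : ℝ) * Complex.exp ((w - ξ) ^ 2 / (2 * τ)) := by
    rw [Complex.ofReal_div]
    ring
  rw [e] at h'
  refine h'.congr fun M => ?_
  rw [sqrt_mul_mul_one_sub hβ₀ hβ₁, Real.sqrt_mul' _ hτ.le]
  push_cast
  field_simp

end

/-! ### Gauge transformation and Gamma function form of the kernel -/

/-- The gauge factor `(-1) ^ x * β ^ x * (1 - β) ^ (t - x)`. -/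
noncomputable def bernoulliGauge (β : ℝ) (t : ℕ) (x : ℤ) : ℝ :=
  (-1) ^ x * β ^ x * (1 - β) ^ ((t : ℤ) - x)

theorem bernoulliGauge_ne_zero {β : ℝ} (hβ₀ : 0 < β) (hβ₁ : β < 1) (t : ℕ) (x : ℤ) :
    bernoulliGauge β t x ≠ 0 :=
  mul_ne_zero (mul_ne_zero (zpow_ne_zero _ (by norm_num)) (zpow_ne_zero _ hβ₀.ne'))
    (zpow_ne_zero _ (sub_pos.2 hβ₁).ne')

theorem ofReal_zpow_eq_cexp {β : ℝ} (hβ : 0 < β) (n : ℤ) :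
    ((β ^ n : ℝ) : ℂ) = Complex.exp (n * (Real.log β : ℝ)) := by
  rw [Complex.exp_int_mul, ← Complex.ofReal_exp, Real.exp_log hβ, Complex.ofReal_zpow]

theorem ofReal_bernoulliGauge {β : ℝ} (hβ₀ : 0 < β) (hβ₁ : β < 1) (t : ℕ) (x : ℤ) :
    (bernoulliGauge β t x : ℂ)
      = (-1) ^ x * Complex.exp (x * (Real.log β : ℝ) + (t - x) * (Real.log (1 - β) : ℝ)) := by
  rw [bernoulliGauge, Complex.ofReal_mul, Complex.ofReal_mul, ofReal_zpow_eq_cexp hβ₀,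
    ofReal_zpow_eq_cexp (sub_pos.2 hβ₁), Complex.exp_add, Complex.ofReal_zpow]
  push_cast
  ring

theorem neg_one_zpow_mul_self (x : ℤ) : (-1 : ℂ) ^ x * (-1) ^ x = 1 := by
  rw [← mul_zpow]
  simp

theorem ne_intCast_of_sin_pi_mul_ne_zero {w : ℂ} (hw : Complex.sin (π * w) ≠ 0) (k : ℤ) :
    w ≠ k := by
  rintro rfl
  apply hw
  rw [mul_comm]
  exact Complex.sin_int_mul_pi k

theorem sin_pi_mul_sub_int (w : ℂ) (x : ℤ) :
    Complex.sin (π * (w - x)) = (-1) ^ x * Complex.sin (π * w) := by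
  have e : π * (w - x) = π * w - x * π := by ring
  rw [e, Complex.sin_antiperiodic.sub_int_mul_eq, x.cast_negOnePow ℂ]

/-- The Pochhammer symbol is a quotient of two Gammas, and reflection trades the sine for the
reciprocal of a third. Only reciprocal Gammas remain, so the integer singularities in w are
removable. -/
theorem sin_div_pochhammerC {w : ℂ} (hw : Complex.sin (π * w) ≠ 0) (x : ℤ) (t : ℕ) :
    Complex.sin (π * w) / pochhammerC (w - x) (t + 1)
      = π * (-1) ^ x / (Complex.Gamma (x - w + 1) * Complex.Gamma (t - (x - w) + 1)) := by
  have hn := ne_intCast_of_sin_pi_mul_ne_zero hw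
  have h1 : pochhammerC (w - x) (t + 1) = Complex.Gamma (w - x + (t + 1 : ℕ)) / Complex.Gamma (w - x) := by
    rw [pochhammerC, Complex.Gamma_add_nat_div_Gamma_eq]
    intro k hk
    apply hn (x - k)
    push_cast
    linear_combination hk
  have h2 := Complex.Gamma_mul_Gamma_one_sub (w - x)
  rw [sin_pi_mul_sub_int] at h2
  have h3 : Complex.Gamma (w - x) ≠ 0 := Complex.Gamma_ne_zero fun m hm => hn (x - m) (by
    push_cast; linear_combination hm)
  have h4 : Complex.Gamma (x - w + 1) ≠ 0 := Complex.Gamma_ne_zero fun m hm => hn (x + m + 1) (by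
    push_cast; linear_combination -hm)
  have h5 : Complex.Gamma (t - (x - w) + 1) ≠ 0 := Complex.Gamma_ne_zero fun m hm =>
    hn (x - m - t - 1) (by push_cast; linear_combination hm)
  have e1 : (1 : ℂ) - (w - x) = x - w + 1 := by ring
  have e2 : w - x + (t + 1 : ℕ) = t - (x - w) + 1 := by push_cast; ring
  have h6 := neg_one_zpow_mul_self x
  have h7 : (-1 : ℂ) ^ x ≠ 0 := zpow_ne_zero _ (by norm_num)
  rw [e1] at h2
  rw [h1, e2]
  rw [eq_div_iff (mul_ne_zero h7 hw)] at h2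
  field_simp
  linear_combination (-1) ^ x * h2 - Complex.sin (π * w) * Complex.Gamma (w - x)
    * Complex.Gamma (x - w + 1) * h6

/-- Reflection again, now leaving Gammas in the numerator. Their poles satisfy Re z ≥ x or Re z ≤ x
- t, which leaves an open strip of width t free. -/
theorem pochhammerC_div_sin {z : ℂ} (hz : Complex.sin (π * z) ≠ 0) (x : ℤ) {t : ℕ} (ht : 1 ≤ t) :
    pochhammerC (z - x + 1) (t - 1) / Complex.sin (π * z)
      = -((-1) ^ x * (Complex.Gamma (x - z) * Complex.Gamma (t - (x - z)))) / π := by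
  have hn := ne_intCast_of_sin_pi_mul_ne_zero hz
  have h1 : pochhammerC (z - x + 1) (t - 1)
      = Complex.Gamma (z - x + 1 + (t - 1 : ℕ)) / Complex.Gamma (z - x + 1) := by
    rw [pochhammerC, Complex.Gamma_add_nat_div_Gamma_eq]
    intro k hk
    apply hn (x - 1 - k)
    push_cast
    linear_combination hk
  have h2 := Complex.Gamma_mul_Gamma_one_sub (x - z)
  have h3 : Complex.Gamma (z - x + 1) ≠ 0 := Complex.Gamma_ne_zero fun m hm => hn (x - m - 1) (by
    push_cast; linear_combination hm)
  have e1 : (1 : ℂ) - (x - z) = z - x + 1 := by ring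
  have e2 : z - x + 1 + (t - 1 : ℕ) = t - (x - z) := by push_cast [Nat.cast_sub ht]; ring
  have e3 : (π : ℂ) * (x - z) = -(π * (z - x)) := by ring
  rw [e1, e3, Complex.sin_neg, sin_pi_mul_sub_int] at h2
  have h6 := neg_one_zpow_mul_self x
  have h7 : (-1 : ℂ) ^ x ≠ 0 := zpow_ne_zero _ (by norm_num)
  have h8 : (π : ℂ) ≠ 0 := by exact_mod_cast Real.pi_ne_zero
  rw [h1, e2]
  rw [eq_div_iff (neg_ne_zero.2 (mul_ne_zero h7 hz))] at h2
  rw [div_div, div_eq_div_iff (mul_ne_zero h3 hz) h8]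
  linear_combination -Complex.Gamma (t - (x - z)) * h2

theorem cpow_odds {β : ℝ} (hβ₀ : 0 < β) (hβ₁ : β < 1) (u : ℂ) :
    (((1 - β) / β : ℝ) : ℂ) ^ u
      = Complex.exp (u * ((Real.log (1 - β) : ℝ) - (Real.log β : ℝ))) := by
  have h1 : 0 < 1 - β := sub_pos.2 hβ₁
  rw [Complex.cpow_def_of_ne_zero (by exact_mod_cast (div_pos h1 hβ₀).ne'), ← Complex.ofReal_log
    (div_pos h1 hβ₀).le, Real.log_div h1.ne' hβ₀.ne', mul_comm]
  push_cast
  rfl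

theorem gauge_mul_integrand {β : ℝ} (hβ₀ : 0 < β) (hβ₁ : β < 1) {t₁ t₂ : ℕ} (ht : 1 ≤ t₂)
    (x₁ x₂ : ℤ) {w z : ℂ} (hw : Complex.sin (π * w) ≠ 0) (hz : Complex.sin (π * z) ≠ 0) :
    ((bernoulliGauge β t₁ x₁ / bernoulliGauge β t₂ x₂ : ℝ) : ℂ)
      * (((t₁.factorial : ℂ) / ((t₂ - 1).factorial : ℂ))
      * (pochhammerC (z - x₂ + 1) (t₂ - 1) / pochhammerC (w - x₁) (t₁ + 1)
            * (1 / (w - z))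
            * (Complex.sin (π * w) / Complex.sin (π * z))
            * (((1 - β) / β : ℝ) : ℂ) ^ (w - z)))
      = -(betaWeight β t₂ (x₂ - z) * (binomialWeight β t₁ (x₁ - w) * (1 / (w - z)))) := by
  have e1 : ((t₂ : ℂ)) = ((t₂ - 1 : ℕ) : ℂ) + 1 := by push_cast [Nat.cast_sub ht]; ring
  rw [binomialWeight, betaWeight, Complex.Gamma_nat_eq_factorial]
  nth_rewrite 2 [e1]
  rw [Complex.Gamma_nat_eq_factorial, cpow_odds hβ₀ hβ₁, Complex.ofReal_div,
    ofReal_bernoulliGauge hβ₀ hβ₁, ofReal_bernoulliGauge hβ₀ hβ₁]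
  have h1 := sin_div_pochhammerC hw x₁ t₁
  have h2 := pochhammerC_div_sin hz x₂ ht
  set L := (Real.log β : ℂ)
  set L' := (Real.log (1 - β) : ℂ)
  have hexp : Complex.exp (x₁ * L + (t₁ - x₁) * L') / Complex.exp (x₂ * L + (t₂ - x₂) * L')
      * Complex.exp ((w - z) * (L' - L))
      = Complex.exp (-((x₂ - z) * L + (t₂ - (x₂ - z)) * L'))
        * Complex.exp ((x₁ - w) * L + (t₁ - (x₁ - w)) * L') := by
    rw [← Complex.exp_sub, ← Complex.exp_add, ← Complex.exp_add]
    congr 1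
    ring
  have h8 : (π : ℂ) ≠ 0 := by exact_mod_cast Real.pi_ne_zero
  have h6 := neg_one_zpow_mul_self x₁
  have h7 : (-1 : ℂ) ^ x₂ ≠ 0 := zpow_ne_zero _ (by norm_num)
  calc _ = (-1) ^ x₁ / (-1) ^ x₂ * (Complex.exp (x₁ * L + (t₁ - x₁) * L')
        / Complex.exp (x₂ * L + (t₂ - x₂) * L') * Complex.exp ((w - z) * (L' - L)))
        * ((t₁.factorial : ℂ) / ((t₂ - 1).factorial : ℂ)) * (1 / (w - z))
        * (Complex.sin (π * w) / pochhammerC (w - x₁) (t₁ + 1))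
        * (pochhammerC (z - x₂ + 1) (t₂ - 1) / Complex.sin (π * z)) := by ring
    _ = ((-1) ^ x₁ * (-1) ^ x₁) * ((-1) ^ x₂ / (-1) ^ x₂) * (π / π)
        * -(Complex.exp (-((x₂ - z) * L + (t₂ - (x₂ - z)) * L'))
        * Complex.exp ((x₁ - w) * L + (t₁ - (x₁ - w)) * L')
        * ((t₁.factorial : ℂ) / ((t₂ - 1).factorial : ℂ)) * (1 / (w - z))
        / (Complex.Gamma (x₁ - w + 1) * Complex.Gamma (t₁ - (x₁ - w) + 1))
        * (Complex.Gamma (x₂ - z) * Complex.Gamma (t₂ - (x₂ - z)))) := by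
        rw [hexp, h1, h2]; ring
    _ = _ := by rw [h6, div_self h7, div_self h8]; ring

theorem binomialWeight_natCast (β : ℝ) (n k : ℕ) :
    binomialWeight β n k = n.choose k
      * Complex.exp (k * (Real.log β : ℝ) + (n - k) * (Real.log (1 - β) : ℝ)) := by
  rw [binomialWeight]
  congr 1
  rcases le_or_gt k n with h | h
  · rw [← Nat.cast_sub h, Complex.Gamma_nat_eq_factorial, Complex.Gamma_nat_eq_factorial,
      Complex.Gamma_nat_eq_factorial, Nat.cast_choose ℂ h]
  -- For k > n the denominator sits at a pole of Γ, where `Complex.Gamma` takes the value 0.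
  -- Division by zero then gives 0, which agrees with the vanishing binomial coefficient.
  · have e : (n : ℂ) - k + 1 = -((k - n - 1 : ℕ) : ℂ) := by
      obtain ⟨d, rfl⟩ := Nat.exists_eq_add_of_lt h
      have : n + d + 1 - n - 1 = d := by omega
      rw [this]
      push_cast
      ring
    rw [e, Complex.Gamma_neg_nat_eq_zero, Nat.choose_eq_zero_of_lt h]
    simp

theorem gauge_mul_choose {β : ℝ} (hβ₀ : 0 < β) (hβ₁ : β < 1) {t₁ t₂ : ℕ} (ht : t₂ ≤ t₁)
    {x₁ x₂ : ℤ} (hx : x₂ ≤ x₁) :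
    ((bernoulliGauge β t₁ x₁ / bernoulliGauge β t₂ x₂ : ℝ) : ℂ)
      * ((-1 : ℂ) ^ (x₁ - x₂ + 1) * ((t₁ - t₂).choose (x₁ - x₂).toNat : ℂ))
      = -binomialWeight β ((t₁ : ℝ) - t₂ : ℝ) ((x₁ : ℝ) - x₂ : ℝ) := by
  obtain ⟨n, rfl⟩ := Nat.exists_eq_add_of_le ht
  obtain ⟨k, rfl⟩ := Int.le.dest hx
  have e1 : (((t₂ + n : ℕ) : ℝ) - t₂ : ℝ) = n := by push_cast; ring
  have e2 : (((x₂ + k : ℤ) : ℝ) - x₂ : ℝ) = k := by push_cast; ring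
  have e3 : x₂ + (k : ℤ) - x₂ = k := by ring
  have h7 : (-1 : ℂ) ^ x₂ ≠ 0 := zpow_ne_zero _ (by norm_num)
  have h8 : (-1 : ℂ) ^ k * (-1) ^ k = 1 := by rw [← mul_pow]; simp
  rw [e1, e2, e3, Complex.ofReal_natCast, Complex.ofReal_natCast, binomialWeight_natCast,
    Complex.ofReal_div, ofReal_bernoulliGauge hβ₀ hβ₁, ofReal_bernoulliGauge hβ₀ hβ₁,
    Int.toNat_natCast, Nat.add_sub_cancel_left, mul_div_mul_comm, ← Complex.exp_sub,
    zpow_add₀ (by norm_num), zpow_add₀ (by norm_num), zpow_natCast, zpow_one,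
    mul_div_cancel_left₀ _ h7]
  have e4 : ((x₂ + k : ℤ) : ℂ) * (Real.log β : ℝ)
      + (((t₂ + n : ℕ) : ℂ) - (x₂ + k : ℤ)) * (Real.log (1 - β) : ℝ)
      - (x₂ * (Real.log β : ℝ) + (t₂ - x₂) * (Real.log (1 - β) : ℝ))
      = k * (Real.log β : ℝ) + (n - k) * (Real.log (1 - β) : ℝ) := by
    push_cast
    ring
  rw [e4]
  linear_combination -(n.choose k : ℂ)
    * Complex.exp (k * (Real.log β : ℝ) + (n - k) * (Real.log (1 - β) : ℝ)) * h8

/-! ### Contraction of the w contour by residues -/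

theorem differentiable_binomialWeight (β : ℝ) (t : ℂ) :
    Differentiable ℂ (binomialWeight β t) := by
  have h1 : Differentiable ℂ fun s : ℂ => (Complex.Gamma (s + 1))⁻¹ :=
    Complex.differentiable_one_div_Gamma.comp (differentiable_id.add_const 1)
  have h2 : Differentiable ℂ fun s : ℂ => (Complex.Gamma (t - s + 1))⁻¹ :=
    Complex.differentiable_one_div_Gamma.comp ((differentiable_id.const_sub t).add_const 1)
  have e : binomialWeight β t = fun s => Complex.Gamma (t + 1) * ((Complex.Gamma (s + 1))⁻¹
      * (Complex.Gamma (t - s + 1))⁻¹)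
      * Complex.exp (s * (Real.log β : ℝ) + (t - s) * (Real.log (1 - β) : ℝ)) := by
    funext s
    rw [binomialWeight, div_eq_mul_inv, mul_inv]
  rw [e]
  fun_prop

/-- Partial fractions reduce this to Cauchy's formula; the coefficients come from Lagrange
interpolation of the constant 1 at the distinct nodes. -/
theorem circleIntegral_mul_prod_inv_sub {ι : Type*} [Fintype ι] [Nonempty ι] [DecidableEq ι]
    {a : ι → ℂ} (ha : Function.Injective a) {c : ℂ} {R : ℝ} {ψ : ℂ → ℂ}
    (hψ : DifferentiableOn ℂ ψ (Metric.closedBall c R)) (haR : ∀ r, a r ∈ Metric.ball c R) :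
    ∮ w in C(c, R), ψ w * ∏ r, (w - a r)⁻¹
      = 2 * π * I * ∑ r, Lagrange.nodalWeight Finset.univ a r * ψ (a r) := by
  have hR : 0 < R := Metric.pos_of_mem_ball (haR (Classical.arbitrary ι))
  have hne : ∀ w ∈ Metric.sphere c R, ∀ r, w ≠ a r := by
    rintro w hw r rfl
    exact (Metric.mem_ball.1 (haR r)).ne (Metric.mem_sphere.1 hw)
  have hpf : ∀ w ∈ Metric.sphere c R, ∏ r, (w - a r)⁻¹
      = ∑ r, Lagrange.nodalWeight Finset.univ a r * (w - a r)⁻¹ := by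
    intro w hw
    have h := Lagrange.eval_interpolate_not_at_node (s := Finset.univ) (v := a) (x := w)
      (1 : ι → ℂ) (fun i _ => hne w hw i)
    rw [Lagrange.interpolate_one ha.injOn Finset.univ_nonempty, Polynomial.eval_one,
      Lagrange.eval_nodal] at h
    simp only [Pi.one_apply, mul_one] at h
    rw [Finset.prod_inv_distrib]
    exact (eq_inv_of_mul_eq_one_right h.symm).symm
  have hcong : ∮ w in C(c, R), ψ w * ∏ r, (w - a r)⁻¹
      = ∮ w in C(c, R), ∑ r, Lagrange.nodalWeight Finset.univ a r * ((w - a r)⁻¹ • ψ w) := by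
    refine circleIntegral.integral_congr hR.le fun w hw => ?_
    rw [hpf w hw, Finset.mul_sum]
    refine Finset.sum_congr rfl fun r _ => ?_
    rw [smul_eq_mul]
    ring
  have hint : ∀ r ∈ (Finset.univ : Finset ι), CircleIntegrable
      (fun w => Lagrange.nodalWeight Finset.univ a r * ((w - a r)⁻¹ • ψ w)) c R := by
    intro r _
    refine ContinuousOn.circleIntegrable hR.le ?_
    refine continuousOn_const.mul (ContinuousOn.fun_smul ?_
      (hψ.continuousOn.mono Metric.sphere_subset_closedBall))
    exact (continuousOn_id.sub continuousOn_const).inv₀ fun w hw => sub_ne_zero.2 (hne w hw r)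
  rw [hcong, circleIntegral.integral_fun_sum hint, Finset.mul_sum]
  refine Finset.sum_congr rfl fun r _ => ?_
  rw [circleIntegral.integral_const_mul,
    (hψ.diffContOnCl_ball subset_rfl).circleIntegral_sub_inv_smul (haR r), smul_eq_mul]
  ring

theorem sin_pi_mul_ne_zero_of_ne_intCast {w : ℂ} (hw : ∀ k : ℤ, w ≠ k) : Complex.sin (π * w) ≠ 0 := by
  intro h
  obtain ⟨k, hk⟩ := Complex.sin_eq_zero_iff.1 h
  have hπ : (π : ℂ) ≠ 0 := by exact_mod_cast Real.pi_ne_zero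
  exact hw k (mul_left_cancel₀ hπ (by rw [hk, mul_comm]))

theorem sin_pi_mul_ne_zero_of_re_eq {z : ℂ} {n : ℤ} (hz : z.re = n + 1 / 2) :
    Complex.sin (π * z) ≠ 0 := by
  refine sin_pi_mul_ne_zero_of_ne_intCast fun k hk => ?_
  rw [hk, Complex.intCast_re] at hz
  have : (2 * k : ℝ) = 2 * n + 1 := by linarith
  have : 2 * k = 2 * n + 1 := by exact_mod_cast this
  omega

theorem abs_re_sub_le_of_mem_closedBall {w : ℂ} {x r : ℝ} (hw : w ∈ Metric.closedBall (x : ℂ) r) :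
    |w.re - x| ≤ r := by
  have h := (Complex.abs_re_le_norm (w - x)).trans (mem_closedBall_iff_norm.1 hw)
  simpa using h

/-- The circle meets the real axis only at p - 1/4 and q + 1/4; after multiplication by 4,
integrality fails modulo 4. -/
theorem sin_pi_mul_ne_zero_of_mem_sphere {p q : ℤ} {w : ℂ}
    (hw : w ∈ Metric.sphere (((((p : ℝ) + (q : ℝ)) / 2 : ℝ)) : ℂ)
      (((q : ℝ) - (p : ℝ)) / 2 + 1 / 4)) : Complex.sin (π * w) ≠ 0 := by
  refine sin_pi_mul_ne_zero_of_ne_intCast fun k hk => ?_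
  rw [hk, mem_sphere_iff_norm, ← Complex.ofReal_intCast, ← Complex.ofReal_sub, Complex.norm_real,
    Real.norm_eq_abs] at hw
  rcases abs_cases ((k : ℝ) - ((p : ℝ) + q) / 2) with h | h
  · have : (4 * k : ℝ) = 4 * q + 1 := by linarith [h.1]
    have : 4 * k = 4 * q + 1 := by exact_mod_cast this
    omega
  · have : (4 * k : ℝ) = 4 * p - 1 := by linarith [h.1]
    have : 4 * k = 4 * p - 1 := by exact_mod_cast this
    omega

/-- The Gamma identities hold only off the integers, and no integer lies on these circles. -/
theorem circleAround_congr {p q : ℤ} {f g : ℂ → ℂ}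
    (h : ∀ w, Complex.sin (π * w) ≠ 0 → f w = g w) : circleAround p q f = circleAround p q g := by
  rw [circleAround, circleAround]
  split_ifs with hpq
  · have : (p : ℝ) ≤ q := by exact_mod_cast hpq
    exact circleIntegral.integral_congr (by linarith) fun w hw =>
      h w (sin_pi_mul_ne_zero_of_mem_sphere hw)
  · rfl

theorem const_mul_bernoulliContour (k : ℂ) (t₁ : ℕ) (x₁ : ℤ) (t₂ : ℕ) (x₂ : ℤ) (f : ℂ → ℂ) :
    k * bernoulliContour t₁ x₁ t₂ x₂ f = bernoulliContour t₁ x₁ t₂ x₂ (fun w => k * f w) := by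
  have h : ∀ p q : ℤ, circleAround p q (fun w => k * f w) = k * circleAround p q f := by
    intro p q
    rw [circleAround, circleAround]
    split_ifs
    · rw [circleIntegral.integral_const_mul]
    · rw [mul_zero]
  rw [bernoulliContour, bernoulliContour, h, h, mul_add]

/-- The value does not involve the circle, so two admissible circles can be compared through their
residue sums without deforming one into the other. -/
theorem circleIntegral_cauchy_mul_prod_div {N : ℕ} (hN : 0 < N) {a : Fin N → ℤ}
    (ha : Function.Injective a) {c : ℂ} {R : ℝ} (hac : ∀ r, (a r : ℂ) ∈ Metric.ball c R)
    {φ : ℂ → ℂ} (hφ : Differentiable ℂ φ) {z : ℂ} (hz : z.re < c.re - R) :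
    ∮ w in C(c, R), φ w * (1 / (w - z)) * ∏ r, (z - a r) / (w - a r)
      = (∏ r, (z - a r)) * (2 * π * I * ∑ r, Lagrange.nodalWeight Finset.univ
          (fun r => (a r : ℂ)) r * (φ (a r) * (1 / (a r - z)))) := by
  have : Nonempty (Fin N) := ⟨⟨0, hN⟩⟩
  have hac' : Function.Injective (fun r => (a r : ℂ)) := fun i j h => ha (Int.cast_injective h)
  have hψ : DifferentiableOn ℂ (fun w => φ w * (1 / (w - z))) (Metric.closedBall c R) := by
    refine hφ.differentiableOn.mul (DifferentiableOn.div (differentiableOn_const _)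
      (differentiableOn_id.sub (differentiableOn_const _)) fun w hw h => ?_)
    have h1 : w = z := sub_eq_zero.1 h
    have h2 := (abs_le.1 ((Complex.abs_re_le_norm (w - c)).trans
      (mem_closedBall_iff_norm.1 hw))).1
    rw [h1, Complex.sub_re] at h2
    linarith
  rw [← circleIntegral_mul_prod_inv_sub hac' hψ hac, ← circleIntegral.integral_const_mul]
  congr 1
  funext w
  rw [Finset.prod_div_distrib, Finset.prod_inv_distrib]
  ring

/-- The left circle stays in Re w ≤ x₂ - t₂ + 1/4, short of both z and the a_r, and contributes
zero. The right circle encloses every a_r and has the same residue sum as the target circle. -/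
theorem bernoulliContour_eq_circleIntegral {N : ℕ} (hN : 0 < N) {a : Fin N → ℤ}
    (ha : Function.Injective a) {t₁ t₂ : ℕ} {x₁ x₂ : ℤ} (ha₁ : ∀ r, x₁ - t₁ ≤ a r)
    (ha₂ : ∀ r, x₂ - t₂ + 1 ≤ a r) (ha₃ : ∀ r, a r ≤ x₁) {c : ℂ} {R : ℝ}
    (hc : (x₂ : ℝ) - t₂ + 1 / 2 < c.re - R) (hac : ∀ r, (a r : ℂ) ∈ Metric.ball c R)
    {φ : ℂ → ℂ} (hφ : Differentiable ℂ φ) {z : ℂ} (hz : z.re = (x₂ : ℝ) - t₂ + 1 / 2) :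
    bernoulliContour t₁ x₁ t₂ x₂ (fun w => φ w * (1 / (w - z)) * ∏ r, (z - a r) / (w - a r))
      = ∮ w in C(c, R), φ w * (1 / (w - z)) * ∏ r, (z - a r) / (w - a r) := by
  have key := fun (c : ℂ) (R : ℝ) (hc : (x₂ : ℝ) - t₂ + 1 / 2 < c.re - R)
    (hac : ∀ r, (a r : ℂ) ∈ Metric.ball c R) =>
    circleIntegral_cauchy_mul_prod_div hN ha hac hφ (hz.trans_lt hc)
  have hleft : circleAround (x₁ - t₁) (min x₁ (x₂ - t₂))
      (fun w => φ w * (1 / (w - z)) * ∏ r, (z - a r) / (w - a r)) = 0 := by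
    rw [circleAround]
    split_ifs with hpq
    · have hpq' : ((x₁ - t₁ : ℤ) : ℝ) ≤ ((min x₁ (x₂ - t₂) : ℤ) : ℝ) := by exact_mod_cast hpq
      have hq : ((min x₁ (x₂ - t₂) : ℤ) : ℝ) ≤ x₂ - t₂ := by
        exact_mod_cast min_le_right x₁ (x₂ - t₂)
      have hre : ∀ w ∈ Metric.closedBall
          ((((((x₁ - t₁ : ℤ) : ℝ) + ((min x₁ (x₂ - t₂) : ℤ) : ℝ)) / 2 : ℝ)) : ℂ)
          ((((min x₁ (x₂ - t₂) : ℤ) : ℝ) - ((x₁ - t₁ : ℤ) : ℝ)) / 2 + 1 / 4),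
          w.re ≤ x₂ - t₂ + 1 / 4 := by
        intro w hw
        have := (abs_le.1 (abs_re_sub_le_of_mem_closedBall hw)).2
        linarith
      have hd : DifferentiableOn ℂ (fun w => φ w * (1 / (w - z)) * ∏ r, (z - a r) / (w - a r))
          (Metric.closedBall
          ((((((x₁ - t₁ : ℤ) : ℝ) + ((min x₁ (x₂ - t₂) : ℤ) : ℝ)) / 2 : ℝ)) : ℂ)
          ((((min x₁ (x₂ - t₂) : ℤ) : ℝ) - ((x₁ - t₁ : ℤ) : ℝ)) / 2 + 1 / 4)) := by
        refine (hφ.differentiableOn.mul (DifferentiableOn.div (differentiableOn_const _)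
          (differentiableOn_id.sub (differentiableOn_const _)) fun w hw h => ?_)).mul
          (DifferentiableOn.fun_finsetProd fun r _ => DifferentiableOn.div (differentiableOn_const _)
            (differentiableOn_id.sub (differentiableOn_const _)) fun w hw h => ?_)
        · have h1 : w = z := sub_eq_zero.1 h
          have := hre w hw
          rw [h1, hz] at this
          linarith
        · have h1 : w = a r := sub_eq_zero.1 h
          have := hre w hw
          rw [h1, Complex.intCast_re] at this
          have h3 : ((x₂ : ℝ) - t₂ + 1) ≤ a r := by exact_mod_cast ha₂ r
          linarith
      exact (hd.diffContOnCl_ball subset_rfl).circleIntegral_eq_zero (by linarith)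
    · rfl
  have hright : circleAround (max (x₁ - t₁) (x₂ - t₂ + 1)) x₁
      (fun w => φ w * (1 / (w - z)) * ∏ r, (z - a r) / (w - a r))
      = (∏ r, (z - a r)) * (2 * π * I * ∑ r, Lagrange.nodalWeight Finset.univ
            (fun r => (a r : ℂ)) r * (φ (a r) * (1 / (a r - z)))) := by
    have hp : ∀ r, max (x₁ - t₁) (x₂ - t₂ + 1) ≤ a r := fun r => max_le (ha₁ r) (ha₂ r)
    rw [circleAround, if_pos ((hp ⟨0, hN⟩).trans (ha₃ _))]
    refine key _ _ ?_ fun r => ?_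
    · rw [Complex.ofReal_re]
      have : (x₂ : ℝ) - t₂ + 1 ≤ ((max (x₁ - t₁) (x₂ - t₂ + 1) : ℤ) : ℝ) := by
        exact_mod_cast le_max_right (x₁ - t₁) (x₂ - t₂ + 1)
      linarith
    · rw [mem_ball_iff_norm, ← Complex.ofReal_intCast, ← Complex.ofReal_sub, Complex.norm_real,
        Real.norm_eq_abs, abs_lt]
      have h1 : ((max (x₁ - t₁) (x₂ - t₂ + 1) : ℤ) : ℝ) ≤ a r := by exact_mod_cast hp r
      have h2 : (a r : ℝ) ≤ x₁ := by exact_mod_cast ha₃ r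
      constructor <;> linarith
  rw [bernoulliContour, hleft, hright, zero_add, key c R hc hac]

/-- The integrand of the `z` integral after the `w` contour has been contracted. -/
noncomputable def contractedIntegrand {N : ℕ} (β : ℝ) (a : Fin N → ℤ) (t₁ : ℕ) (x₁ : ℤ) (t₂ : ℕ)
    (x₂ : ℤ) (c : ℂ) (R : ℝ) (z : ℂ) : ℂ :=
  betaWeight β t₂ (x₂ - z) *
    ∮ w in C(c, R), binomialWeight β t₁ (x₁ - w) * (1 / (w - z)) * ∏ r, (z - a r) / (w - a r)

theorem gauge_mul_bernoulliKernel {N : ℕ} (hN : 0 < N) {β : ℝ} (hβ₀ : 0 < β) (hβ₁ : β < 1)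
    {a : Fin N → ℤ} (ha : Function.Injective a) {t₁ t₂ : ℕ} (ht₂ : 1 ≤ t₂) {x₁ x₂ : ℤ}
    (ha₁ : ∀ r, x₁ - t₁ ≤ a r) (ha₂ : ∀ r, x₂ - t₂ + 1 ≤ a r) (ha₃ : ∀ r, a r ≤ x₁) {c : ℂ} {R : ℝ}
    (hc : (x₂ : ℝ) - t₂ + 1 / 2 < c.re - R) (hac : ∀ r, (a r : ℂ) ∈ Metric.ball c R) :
    ((bernoulliGauge β t₁ x₁ / bernoulliGauge β t₂ x₂ : ℝ) : ℂ) * bernoulliKernel β a t₁ x₁ t₂ x₂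
      = (if x₂ ≤ x₁ ∧ t₂ < t₁ then
          -binomialWeight β ((t₁ : ℝ) - t₂ : ℝ) ((x₁ : ℝ) - x₂ : ℝ) else 0)
        - 1 / (2 * π * I) ^ 2 * lineIntegral ((x₂ : ℝ) - t₂ + 1 / 2)
            (contractedIntegrand β a t₁ x₁ t₂ x₂ c R) := by
  rw [bernoulliKernel, mul_add]
  refine (congrArg₂ (· + ·) ?_ ?_).trans (sub_eq_add_neg _ _).symm
  · split_ifs with h
    · exact gauge_mul_choose hβ₀ hβ₁ h.2.le h.1
    · rw [mul_zero]
  set g : ℂ := ((bernoulliGauge β t₁ x₁ / bernoulliGauge β t₂ x₂ : ℝ) : ℂ)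
  set k : ℂ := (t₁.factorial : ℂ) / ((t₂ - 1).factorial : ℂ)
  rw [mul_comm k, mul_assoc, mul_left_comm g, ← mul_neg, ← mul_assoc g]
  congr 1
  rw [lineIntegral, lineIntegral, ← integral_const_mul, ← integral_neg]
  congr 1
  funext y
  rw [← mul_assoc, ← neg_mul]
  congr 1
  set z : ℂ := (((x₂ : ℝ) - t₂ + 1 / 2 : ℝ) : ℂ) + y * I
  have hz : z.re = (x₂ : ℝ) - t₂ + 1 / 2 := by simp [z]
  have hsin : Complex.sin (π * z) ≠ 0 :=
    sin_pi_mul_ne_zero_of_re_eq (n := x₂ - t₂) (by rw [hz]; push_cast; ring)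
  have hφ : Differentiable ℂ fun w : ℂ => binomialWeight β t₁ (x₁ - w) :=
    (differentiable_binomialWeight β t₁).comp (differentiable_id.const_sub _)
  rw [contractedIntegrand, ← bernoulliContour_eq_circleIntegral hN ha ha₁ ha₂ ha₃ hc hac hφ hz,
    ← neg_mul, const_mul_bernoulliContour, const_mul_bernoulliContour]
  have hcongr : ∀ w : ℂ, Complex.sin (π * w) ≠ 0 →
      g * k * (pochhammerC (z - x₂ + 1) (t₂ - 1) / pochhammerC (w - x₁) (t₁ + 1)
            * (1 / (w - z))
            * (Complex.sin (π * w) / Complex.sin (π * z))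
            * (((1 - β) / β : ℝ) : ℂ) ^ (w - z)
            * ∏ r : Fin N, (z - a r) / (w - a r))
      = -betaWeight β t₂ (x₂ - z) * (binomialWeight β t₁ (x₁ - w) * (1 / (w - z))
          * ∏ r, (z - a r) / (w - a r)) := by
    intro w hw
    rw [mul_assoc g k, ← mul_assoc k, ← mul_assoc g,
      gauge_mul_integrand hβ₀ hβ₁ ht₂ x₁ x₂ hw hsin]
    ring
  rw [bernoulliContour, bernoulliContour, circleAround_congr hcongr, circleAround_congr hcongr]

/-! ### Decay of the Beta weight and displacement of the z line -/

theorem lineIntegral_eq_of_differentiableOn_strip {f : ℂ → ℂ} {a b K : ℝ} (hab : a ≤ b)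
    (hd : DifferentiableOn ℂ f (Complex.re ⁻¹' Set.Icc a b))
    (hK : ∀ z : ℂ, z.re ∈ Set.Icc a b → ‖f z‖ ≤ K * (1 + z.im ^ 2)⁻¹) :
    lineIntegral a f = lineIntegral b f := by
  have hint : ∀ x ∈ Set.Icc a b, Integrable fun y : ℝ => f ((x : ℂ) + y * I) := by
    intro x hx
    refine (integrable_inv_one_add_sq.const_mul K).mono' ?_ (Eventually.of_forall fun y => ?_)
    · refine Continuous.aestronglyMeasurable ?_
      refine hd.continuousOn.comp_continuous (by fun_prop) fun y => ?_
      simpa using hx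
    · simpa using hK ((x : ℂ) + y * I) (by simpa using hx)
  have hvert : ∀ x ∈ Set.Icc a b, Tendsto (fun T : ℝ => ∫ y in (-T)..T, f ((x : ℂ) + y * I)) atTop
      (𝓝 (∫ y : ℝ, f ((x : ℂ) + y * I))) := fun x hx =>
    intervalIntegral_tendsto_integral (hint x hx) tendsto_neg_atTop_atBot tendsto_id
  -- Taking g T = T and g T = -T treats the top and bottom edges of the rectangle at once.
  have hhor : ∀ g : ℝ → ℝ, (∀ T, g T ^ 2 = T ^ 2) →
      Tendsto (fun T : ℝ => ∫ x in a..b, f ((x : ℂ) + (g T : ℝ) * I)) atTop (𝓝 0) := by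
    intro g hg
    have hlim : Tendsto (fun T : ℝ => K * (1 + T ^ 2)⁻¹ * |b - a|) atTop (𝓝 0) := by
      have h1 : Tendsto (fun T : ℝ => 1 + T ^ 2) atTop atTop :=
        tendsto_atTop_add_const_left _ _ (tendsto_pow_atTop two_ne_zero)
      simpa using (h1.inv_tendsto_atTop.const_mul K).mul_const |b - a|
    refine squeeze_zero_norm (fun T => ?_) hlim
    refine intervalIntegral.norm_integral_le_of_norm_le_const fun x hx => ?_
    rw [Set.uIoc_of_le hab] at hx
    have h := hK ((x : ℂ) + (g T : ℝ) * I) (by simpa using Set.Ioc_subset_Icc_self hx)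
    simpa [hg T] using h
  have hrect : ∀ T : ℝ, (((∫ x in a..b, f ((x : ℂ) + ((-T : ℝ) : ℂ) * I))
      - ∫ x in a..b, f ((x : ℂ) + (T : ℝ) * I))
      + I * ∫ y in (-T)..T, f ((b : ℂ) + y * I)) - I * ∫ y in (-T)..T, f ((a : ℂ) + y * I) = 0 := by
    intro T
    have h := Complex.integral_boundary_rect_eq_zero_of_differentiableOn f
      ((a : ℂ) + ((-T : ℝ) : ℂ) * I) ((b : ℂ) + (T : ℝ) * I) (hd.mono fun z hz => by
        have := (Complex.mem_reProdIm.1 hz).1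
        simpa [Set.uIcc_of_le hab] using this)
    simpa using h
  have hlim := ((((hhor (fun T => -T) (fun T => by ring)).sub (hhor id fun _ => rfl)).add
    ((hvert b ⟨hab, le_rfl⟩).const_mul I)).sub ((hvert a ⟨le_rfl, hab⟩).const_mul I))
  simp only [id] at hlim
  simp_rw [hrect] at hlim
  have h := tendsto_nhds_unique hlim tendsto_const_nhds
  rw [lineIntegral, lineIntegral, integral_mul_const, integral_mul_const]
  linear_combination -h

theorem norm_Gamma_le_norm_Gamma_re {s : ℂ} (hs : 0 < s.re) :
    ‖Complex.Gamma s‖ ≤ ‖Complex.Gamma (s.re : ℂ)‖ := by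
  have h1 : Complex.Gamma (s.re : ℂ)
      = ((∫ v : ℝ, Real.exp (s.re * v - Real.exp v) : ℝ) : ℂ) := by
    rw [Gamma_eq_integral_cexp (by simpa using hs), ← integral_complex_ofReal]
    congr 1
    funext v
    push_cast
    rfl
  have h2 : ∀ v : ℝ, Real.exp (s.re * v - Real.exp v) = ‖Complex.exp (s * v - Real.exp v)‖ := by
    intro v
    rw [Complex.norm_exp]
    simp [Complex.exp_ofReal_re]
  rw [h1, Complex.norm_real, Real.norm_of_nonneg (integral_nonneg fun v => (Real.exp_pos _).le),
    Gamma_eq_integral_cexp hs]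
  simp_rw [h2]
  exact norm_integral_le_integral_norm _

theorem Gamma_add_natCast {s : ℂ} (hs : 0 < s.re) (n : ℕ) :
    Complex.Gamma (s + n) = Complex.Gamma s * ∏ j ∈ Finset.range n, (s + j) := by
  induction n with
  | zero => simp
  | succ n ih =>
    have h : s + n ≠ 0 := by
      intro h
      have := congrArg Complex.re h
      simp at this
      have h' : (0 : ℝ) ≤ n := n.cast_nonneg
      linarith
    rw [Finset.prod_range_succ, Nat.cast_succ, ← add_assoc, Complex.Gamma_add_one _ h, ih]
    ring

/-- Move s to s + 2k by the functional equation and use the trivial bound there. Each of the 2k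
factors satisfies |s + j| ≥ (x + j)ρ, with ρ² the base of the power, so returning to s gains ρ^(2k).
-/
theorem norm_Gamma_mul_pow_le {s : ℂ} (hs : 0 < s.re) (k : ℕ) :
    ‖Complex.Gamma s‖ * (1 + s.im ^ 2 / (s.re + 2 * k) ^ 2) ^ k
      ≤ ‖Complex.Gamma (s.re : ℂ)‖ := by
  set x := s.re
  set ρ := √(1 + s.im ^ 2 / (x + 2 * k) ^ 2)
  have hρ : ρ ^ 2 = 1 + s.im ^ 2 / (x + 2 * k) ^ 2 := Real.sq_sqrt (by positivity)
  have hj : ∀ j ∈ Finset.range (2 * k), (x + j) * ρ ≤ ‖s + j‖ := by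
    intro j hj
    have hjk : (j : ℝ) ≤ 2 * k := by exact_mod_cast (Finset.mem_range.1 hj).le
    have hj0 : (0 : ℝ) ≤ j := j.cast_nonneg
    refine le_of_sq_le_sq ?_ (norm_nonneg _)
    rw [mul_pow, hρ, ← Complex.normSq_eq_norm_sq, Complex.normSq_apply]
    have h1 : (s + j).re = x + j := by simp [x]
    have h2 : (s + j).im = s.im := by simp
    rw [h1, h2]
    have h3 : (x + j) ^ 2 / (x + 2 * k) ^ 2 ≤ 1 := by
      rw [div_le_one (by positivity)]
      gcongr
    have h4 : (x + j) ^ 2 * (1 + s.im ^ 2 / (x + 2 * k) ^ 2)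
        = (x + j) ^ 2 + s.im ^ 2 * ((x + j) ^ 2 / (x + 2 * k) ^ 2) := by ring
    rw [h4]
    nlinarith [mul_le_mul_of_nonneg_left h3 (sq_nonneg s.im)]
  have hprod : (∏ j ∈ Finset.range (2 * k), (x + j)) * ρ ^ (2 * k)
      ≤ ∏ j ∈ Finset.range (2 * k), ‖s + j‖ := by
    have : ρ ^ (2 * k) = ∏ j ∈ Finset.range (2 * k), ρ := by simp
    rw [this, ← Finset.prod_mul_distrib]
    exact Finset.prod_le_prod (fun j _ => by positivity) hj
  have hP : 0 < ∏ j ∈ Finset.range (2 * k), (x + j) :=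
    Finset.prod_pos fun j _ => by positivity
  have hG := norm_Gamma_le_norm_Gamma_re (s := s + (2 * k : ℕ)) (by
    simp only [Complex.add_re, Complex.natCast_re]; positivity)
  have hx : (((s + (2 * k : ℕ)).re : ℝ) : ℂ) = (x : ℂ) + (2 * k : ℕ) := by
    simp [x]
  rw [hx, Gamma_add_natCast hs, Gamma_add_natCast (by simpa using hs), norm_mul, norm_mul,
    norm_prod, norm_prod] at hG
  have hxj : ∏ j ∈ Finset.range (2 * k), ‖(x : ℂ) + j‖ = ∏ j ∈ Finset.range (2 * k), (x + j) := by
    refine Finset.prod_congr rfl fun j _ => ?_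
    rw [← Complex.ofReal_natCast, ← Complex.ofReal_add, Complex.norm_real,
      Real.norm_of_nonneg (by positivity)]
  rw [hxj] at hG
  rw [← hρ, ← pow_mul]
  refine le_of_mul_le_mul_right ?_ hP
  calc _ = ‖Complex.Gamma s‖ * ((∏ j ∈ Finset.range (2 * k), (x + j)) * ρ ^ (2 * k)) := by ring
    _ ≤ _ := by gcongr
    _ ≤ _ := hG

/-- Only Γ(s) is improved. The other Gamma gets the trivial bound, and the modulus of the
exponential depends on Re s alone. -/
theorem norm_betaWeight_mul_pow_le (β : ℝ) {t : ℝ} {s : ℂ} (hs : 0 < s.re) (hst : s.re < t)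
    (k : ℕ) :
    ‖betaWeight β t s‖ * (1 + s.im ^ 2 / (s.re + 2 * k) ^ 2) ^ k
      ≤ ‖betaWeight β t (s.re : ℂ)‖ := by
  have h1 := norm_Gamma_mul_pow_le hs k
  have h2 := norm_Gamma_le_norm_Gamma_re (s := (t : ℂ) - s) (by simpa using hst)
  have h3 : (((t : ℂ) - s).re : ℂ) = (t : ℂ) - (s.re : ℂ) := by simp
  rw [h3] at h2
  have h4 : ‖Complex.exp (-(s * (Real.log β : ℝ) + (t - s) * (Real.log (1 - β) : ℝ)))‖
      = ‖Complex.exp (-((s.re : ℂ) * (Real.log β : ℝ) + (t - (s.re : ℂ))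
        * (Real.log (1 - β) : ℝ)))‖ := by
    rw [Complex.norm_exp, Complex.norm_exp]
    simp
  rw [betaWeight, betaWeight, norm_mul, norm_mul, norm_div, norm_div, norm_mul, norm_mul, h4]
  set E := ‖Complex.exp (-((s.re : ℂ) * (Real.log β : ℝ) + (t - (s.re : ℂ))
        * (Real.log (1 - β) : ℝ)))‖
  calc _ = (‖Complex.Gamma s‖ * (1 + s.im ^ 2 / (s.re + 2 * k) ^ 2) ^ k)
        * ‖Complex.Gamma (t - s)‖ / ‖Complex.Gamma (t : ℂ)‖ * E := by ring
    _ ≤ _ := by gcongr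

theorem differentiableAt_betaWeight (β : ℝ) {t : ℝ} {s : ℂ} (hs : 0 < s.re) (hst : s.re < t) :
    DifferentiableAt ℂ (betaWeight β t) s := by
  have hG : ∀ u : ℂ, 0 < u.re → DifferentiableAt ℂ Complex.Gamma u := fun u hu =>
    Complex.differentiableAt_Gamma u fun m h => by
      have := congrArg Complex.re h
      simp only [Complex.neg_re, Complex.natCast_re] at this
      have h' : (0 : ℝ) ≤ m := m.cast_nonneg
      linarith
  have h2 : DifferentiableAt ℂ (fun s : ℂ => Complex.Gamma (t - s)) s :=
    (hG (t - s) (by simpa using hst)).comp s (differentiableAt_id.const_sub _)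
  have h1 := hG s hs
  unfold betaWeight
  fun_prop

theorem norm_sub_le_mul_one_add_im_sq {z a : ℂ} {A B : ℝ} (hz : |z.re| ≤ B) (ha : ‖a‖ ≤ A) :
    ‖z - a‖ ≤ (B + A + 1) * (1 + z.im ^ 2) := by
  have h1 := Complex.norm_le_abs_re_add_abs_im z
  have h2 := norm_sub_le z a
  have h3 : |z.im| ≤ 1 + z.im ^ 2 := by nlinarith [sq_abs z.im, sq_nonneg (|z.im| - 1), abs_nonneg z.im]
  have hB : 0 ≤ B := (abs_nonneg _).trans hz
  have hA : 0 ≤ A := (norm_nonneg _).trans ha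
  nlinarith [mul_nonneg hB (sq_nonneg z.im), mul_nonneg hA (sq_nonneg z.im)]

theorem exists_norm_betaWeight_le (β : ℝ) {t p q : ℝ} (hp : 0 < p) (hq : q < t) (k : ℕ) (hk : 1 ≤ k) :
    ∃ C, 0 ≤ C ∧ ∀ s : ℂ, s.re ∈ Set.Icc p q → ‖betaWeight β t s‖ * (1 + s.im ^ 2) ^ k ≤ C := by
  have hcont : ContinuousOn (fun x : ℝ => betaWeight β t (x : ℂ) * (((x + 2 * k) ^ 2) ^ k : ℝ))
      (Set.Icc p q) := by
    intro x hx
    have h1 : ContinuousAt (betaWeight β t) (x : ℂ) :=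
      (differentiableAt_betaWeight β (by simpa using hp.trans_le hx.1)
        (by simpa using hx.2.trans_lt hq)).continuousAt
    have h2 : ContinuousAt (fun x : ℝ => betaWeight β t (x : ℂ)) x :=
      ContinuousAt.comp (f := fun x : ℝ => (x : ℂ)) h1 Complex.continuous_ofReal.continuousAt
    have h3 : Continuous fun x : ℝ => ((((x + 2 * k) ^ 2) ^ k : ℝ) : ℂ) := by fun_prop
    exact (h2.mul h3.continuousAt).continuousWithinAt
  obtain ⟨C, hC⟩ := isCompact_Icc.exists_bound_of_continuousOn hcont
  refine ⟨max C 0, le_max_right _ _, fun s hs => (le_trans ?_ (hC s.re hs)).trans (le_max_left _ _)⟩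
  have hre : 0 < s.re := hp.trans_le hs.1
  have h := norm_betaWeight_mul_pow_le β hre (hs.2.trans_lt hq) k
  have hk' : (1 : ℝ) ≤ k := by exact_mod_cast hk
  have hbig : (1 : ℝ) ≤ (s.re + 2 * k) ^ 2 := by nlinarith
  rw [norm_mul, Complex.norm_real, Real.norm_of_nonneg (by positivity)]
  calc _ ≤ ‖betaWeight β t s‖ * ((1 + s.im ^ 2 / (s.re + 2 * k) ^ 2) * (s.re + 2 * k) ^ 2) ^ k := by
        gcongr
        rw [add_mul, one_mul, div_mul_cancel₀ _ (by positivity)]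
        gcongr
    _ = ‖betaWeight β t s‖ * (1 + s.im ^ 2 / (s.re + 2 * k) ^ 2) ^ k * ((s.re + 2 * k) ^ 2) ^ k := by
        rw [mul_pow]; ring
    _ ≤ _ := by gcongr

/-- On the strip the circle integral equals its residue sum, a rational function of z, which makes
holomorphy and growth explicit. -/
theorem lineIntegral_contractedIntegrand_eq {N : ℕ} (hN : 0 < N) (β : ℝ)
    {a : Fin N → ℤ} (ha : Function.Injective a) {t₁ t₂ : ℕ} {x₁ x₂ : ℤ} {c : ℂ} {R p q : ℝ}
    (hpq : p ≤ q) (hp : (x₂ : ℝ) - t₂ < p) (hqx : q < x₂) (hqc : q < c.re - R)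
    (hac : ∀ r, (a r : ℂ) ∈ Metric.ball c R) :
    lineIntegral p (contractedIntegrand β a t₁ x₁ t₂ x₂ c R)
      = lineIntegral q (contractedIntegrand β a t₁ x₁ t₂ x₂ c R) := by
  have hφ : Differentiable ℂ fun w : ℂ => binomialWeight β t₁ (x₁ - w) :=
    (differentiable_binomialWeight β t₁).comp (differentiable_id.const_sub _)
  set κ : Fin N → ℂ := fun r => Lagrange.nodalWeight Finset.univ (fun r => (a r : ℂ)) r
    * binomialWeight β t₁ (x₁ - a r)
  have haq : ∀ r, q < a r := by
    intro r
    have h2 := (abs_lt.1 ((Complex.abs_re_le_norm _).trans_lt (mem_ball_iff_norm.1 (hac r)))).1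
    rw [Complex.sub_re, Complex.intCast_re] at h2
    linarith
  set G : ℂ → ℂ := fun z => betaWeight β (t₂ : ℝ) (x₂ - z) * ((∏ r, (z - a r))
      * (2 * π * I * ∑ r, κ r * (1 / (a r - z))))
  have hFG : ∀ z : ℂ, z.re ≤ q → contractedIntegrand β a t₁ x₁ t₂ x₂ c R z = G z := by
    intro z hz
    rw [contractedIntegrand, circleIntegral_cauchy_mul_prod_div hN ha hac hφ (hz.trans_lt hqc)]
    simp only [G, κ, mul_assoc, Complex.ofReal_natCast]
  have hcongr : ∀ x ≤ q, lineIntegral x (contractedIntegrand β a t₁ x₁ t₂ x₂ c R)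
      = lineIntegral x G := by
    intro x hx
    rw [lineIntegral, lineIntegral]
    congr 1
    funext y
    rw [hFG _ (by simpa using hx)]
  rw [hcongr p hpq, hcongr q le_rfl]
  have hd : DifferentiableOn ℂ G (Complex.re ⁻¹' Set.Icc p q) := by
    intro z hz
    have hz' : z.re ∈ Set.Icc p q := hz
    have h1 : DifferentiableAt ℂ (fun z : ℂ => betaWeight β (t₂ : ℝ) (x₂ - z)) z := by
      refine DifferentiableAt.comp (f := fun z : ℂ => (x₂ : ℂ) - z) z
        (differentiableAt_betaWeight β ?_ ?_) (differentiableAt_id.const_sub _)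
      · simp only [Complex.sub_re, Complex.intCast_re]; linarith [hz'.2]
      · simp only [Complex.sub_re, Complex.intCast_re]; linarith [hz'.1]
    have h2 : DifferentiableAt ℂ (fun z : ℂ => ∑ r, κ r * (1 / (a r - z))) z := by
      refine DifferentiableAt.fun_sum fun r _ => DifferentiableAt.const_mul ?_ _
      refine DifferentiableAt.div (differentiableAt_const _) (differentiableAt_id.const_sub _) ?_
      intro h
      have h3 := congrArg Complex.re h
      simp only [Complex.sub_re, Complex.intCast_re, Complex.zero_re] at h3
      linarith [haq r, hz'.2]
    have h3 : DifferentiableAt ℂ (fun z : ℂ => ∏ r, (z - a r)) z := by fun_prop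
    exact (h1.mul (h3.mul (h2.const_mul _))).differentiableWithinAt
  -- Of the N + 1 powers of 1 + y², N absorb the product of the z - a_r and the last one makes the
  -- integrand integrable.
  obtain ⟨C, hC0, hC⟩ := exists_norm_betaWeight_le β (t := t₂) (p := x₂ - q) (q := x₂ - p)
    (by linarith) (by linarith) (N + 1) (by omega)
  set B := |p| + |q|
  set A := ∑ r, ‖(a r : ℂ)‖
  set D := ‖2 * (π : ℂ) * I‖ * ∑ r, ‖κ r‖ * (1 / (a r - q))
  have hD : 0 ≤ D := by
    refine mul_nonneg (norm_nonneg _) (Finset.sum_nonneg fun r _ => ?_)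
    have : 0 < (a r : ℝ) - q := sub_pos.2 (haq r)
    positivity
  have hA : 0 ≤ A := Finset.sum_nonneg fun r _ => norm_nonneg _
  refine lineIntegral_eq_of_differentiableOn_strip (K := C * (B + A + 1) ^ N * D) hpq hd
    fun z hz => ?_
  have h1 := hC (x₂ - z) (by
    simp only [Complex.sub_re, Complex.intCast_re]; constructor <;> linarith [hz.1, hz.2])
  have him : ((x₂ : ℂ) - z).im ^ 2 = z.im ^ 2 := by simp
  rw [him] at h1
  have hzB : |z.re| ≤ B := by
    rw [abs_le]
    constructor
    · linarith [hz.1, neg_abs_le p, abs_nonneg q]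
    · linarith [hz.2, le_abs_self q, abs_nonneg p]
  have h2 : ‖∏ r, (z - a r)‖ ≤ (B + A + 1) ^ N * (1 + z.im ^ 2) ^ N := by
    rw [norm_prod, ← mul_pow]
    calc _ ≤ ∏ _r : Fin N, (B + A + 1) * (1 + z.im ^ 2) := by
          refine Finset.prod_le_prod (fun r _ => norm_nonneg _) fun r _ =>
            norm_sub_le_mul_one_add_im_sq hzB ?_
          exact Finset.single_le_sum (f := fun r => ‖(a r : ℂ)‖) (fun r _ => norm_nonneg _)
            (Finset.mem_univ r)
      _ = _ := by simp
  have h3 : ‖2 * (π : ℂ) * I * ∑ r, κ r * (1 / (a r - z))‖ ≤ D := by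
    rw [norm_mul]
    refine mul_le_mul_of_nonneg_left ((norm_sum_le _ _).trans (Finset.sum_le_sum fun r _ => ?_))
      (norm_nonneg _)
    rw [norm_mul, norm_div, norm_one]
    have h4 : 0 < (a r : ℝ) - q := sub_pos.2 (haq r)
    have h5 : (a r : ℝ) - q ≤ ‖(a r : ℂ) - z‖ := by
      refine le_trans ?_ (Complex.re_le_norm _)
      rw [Complex.sub_re, Complex.intCast_re]
      linarith [hz.2]
    gcongr
  have hpos : 0 < 1 + z.im ^ 2 := by positivity
  rw [norm_mul, norm_mul]
  calc _ ≤ ‖betaWeight β (t₂ : ℝ) (x₂ - z)‖ * (((B + A + 1) ^ N * (1 + z.im ^ 2) ^ N) * D) := by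
        gcongr
    _ = (‖betaWeight β (t₂ : ℝ) (x₂ - z)‖ * (1 + z.im ^ 2) ^ (N + 1)) * (B + A + 1) ^ N * D
          * (1 + z.im ^ 2)⁻¹ := by
        field_simp
        ring
    _ ≤ _ := by
      have hBA : 0 ≤ (B + A + 1) ^ N := by positivity
      exact mul_le_mul_of_nonneg_right (mul_le_mul_of_nonneg_right (mul_le_mul_of_nonneg_right h1
        hBA) hD) (inv_nonneg.2 hpos.le)

/-! ### Rescaling of the contours -/

theorem circleIntegral_comp_real_mul (S : ℝ) (c : ℂ) (R : ℝ) (f : ℂ → ℂ) :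
    ∮ w in C(S * c, S * R), f w = S * ∮ w in C(c, R), f (S * w) := by
  have h : ∀ θ : ℝ, circleMap (S * c) (S * R) θ = S * circleMap c R θ := by
    intro θ
    simp only [circleMap]
    push_cast
    ring
  have h0 : ∀ θ : ℝ, circleMap 0 (S * R) θ = S * circleMap 0 R θ := by
    intro θ
    simp only [circleMap]
    push_cast
    ring
  rw [circleIntegral, circleIntegral, ← intervalIntegral.integral_const_mul]
  congr 1
  funext θ
  rw [deriv_circleMap, deriv_circleMap, h, h0, smul_eq_mul, smul_eq_mul]
  ring

theorem lineIntegral_comp_real_mul {S : ℝ} (hS : 0 < S) (c : ℝ) (f : ℂ → ℂ) :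
    lineIntegral (S * c) f = S * lineIntegral c (fun z => f (S * z)) := by
  have h := Measure.integral_comp_mul_left
    (fun y : ℝ => f (((S * c : ℝ) : ℂ) + (y : ℂ) * I) * I) S
  rw [abs_of_pos (inv_pos.2 hS), Complex.real_smul] at h
  have hS' : (S : ℂ) ≠ 0 := by exact_mod_cast hS.ne'
  rw [lineIntegral, lineIntegral]
  have e : ∫ y : ℝ, f (S * ((c : ℂ) + (y : ℂ) * I)) * I
      = ∫ y : ℝ, f (((S * c : ℝ) : ℂ) + ((S * y : ℝ) : ℂ) * I) * I := by
    congr 1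
    funext y
    push_cast
    ring_nf
  rw [e, h, ← mul_assoc, Complex.ofReal_inv, mul_inv_cancel₀ hS', one_mul]

/-- Here dz and dw each give S, the Cauchy factor gives 1/S, and the normalization of the kernel
gives S. The resulting S² is shared equally between the two weights. -/
theorem scale_lineIntegral_contractedIntegrand {N : ℕ} (β : ℝ) (a : Fin N → ℤ) (t₁ : ℕ) (x₁ : ℤ)
    (t₂ : ℕ) (x₂ : ℤ) (w₀ : ℂ) (R : ℝ) (c : ℝ) {S : ℝ} (hS : 0 < S) :
    S * lineIntegral (S * c) (contractedIntegrand β a t₁ x₁ t₂ x₂ (S * w₀) (S * R))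
      = lineIntegral c (fun z => (S * betaWeight β t₂ (x₂ - S * z)) *
          ∮ w in C(w₀, R), (S * binomialWeight β t₁ (x₁ - S * w)) * (1 / (w - z))
            * ∏ r, (z - a r / S) / (w - a r / S)) := by
  have hS' : (S : ℂ) ≠ 0 := by exact_mod_cast hS.ne'
  rw [lineIntegral_comp_real_mul hS, lineIntegral, lineIntegral, ← integral_const_mul,
    ← integral_const_mul]
  congr 1
  funext y
  rw [← mul_assoc, ← mul_assoc]
  congr 1
  set z : ℂ := (c : ℂ) + y * I
  rw [contractedIntegrand, circleIntegral_comp_real_mul, ← circleIntegral.integral_const_mul,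
    ← circleIntegral.integral_const_mul, ← circleIntegral.integral_const_mul,
    ← circleIntegral.integral_const_mul]
  congr 1
  funext w
  have hprod : ∏ r, (S * z - a r) / (S * w - a r) = ∏ r, (z - a r / S) / (w - a r / S) := by
    refine Finset.prod_congr rfl fun r _ => ?_
    rw [← mul_div_mul_left (z - a r / S) _ hS', mul_sub, mul_sub, mul_div_cancel₀ _ hS']
  have hinv : (S : ℂ) * (1 / (S * w - S * z)) = 1 / (w - z) := by
    rw [← mul_sub, mul_one_div, div_mul_eq_div_div, div_self hS']
  rw [hprod, ← hinv]
  ring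

/-! ### Dominated convergence for the double integral -/

theorem exists_eventually_norm_le_of_isCompact {ι : Type*} {l : Filter ι} {g : ι → ℂ → ℂ}
    {G : ℂ → ℂ} {K : Set ℂ} (hK : IsCompact K)
    (hg : ∀ w ∈ K, Tendsto (fun q : ι × ℂ => g q.1 q.2) (l ×ˢ 𝓝 w) (𝓝 (G w))) :
    ∃ C, ∀ᶠ i in l, ∀ w ∈ K, ‖g i w‖ ≤ C := by
  refine hK.induction_on (p := fun s => ∃ C, ∀ᶠ i in l, ∀ w ∈ s, ‖g i w‖ ≤ C) ⟨0, by simp⟩ ?_ ?_ ?_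
  · rintro s t hst ⟨C, hC⟩
    exact ⟨C, hC.mono fun i hi w hw => hi w (hst hw)⟩
  · rintro s t ⟨C, hC⟩ ⟨D, hD⟩
    refine ⟨max C D, ?_⟩
    filter_upwards [hC, hD] with i h1 h2 w hw
    rcases hw with hw | hw
    · exact (h1 w hw).trans (le_max_left _ _)
    · exact (h2 w hw).trans (le_max_right _ _)
  · intro w hw
    have h := (hg w hw).norm.eventually (eventually_lt_nhds (lt_add_one ‖G w‖))
    obtain ⟨pa, ha, pb, hb, hab⟩ := eventually_prod_iff.1 h
    refine ⟨{w | pb w}, mem_nhdsWithin_of_mem_nhds hb, ‖G w‖ + 1, ha.mono fun i hi w' hw' => ?_⟩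
    exact (hab hi hw').le

theorem norm_cauchyKernel_le {N : ℕ} {w₀ : ℂ} {R ρ c A C : ℝ} (hρR : ρ < R) (hc : c < w₀.re - R)
    {φ : ℂ → ℂ} {b : Fin N → ℂ} (hb : ∀ r, b r ∈ Metric.ball w₀ ρ) (hA : ∀ r, ‖b r‖ ≤ A)
    (hA0 : 0 ≤ A)
    (hφ : ∀ w ∈ Metric.sphere w₀ R, ‖φ w‖ ≤ C) {z : ℂ} (hz : z.re = c) {w : ℂ}
    (hw : w ∈ Metric.sphere w₀ R) :
    ‖φ w * (1 / (w - z)) * ∏ r, (z - b r) / (w - b r)‖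
      ≤ C * (1 / (w₀.re - R - c)) * ((|c| + A + 1) * (1 + z.im ^ 2) / (R - ρ)) ^ N := by
  have hC : 0 ≤ C := (norm_nonneg _).trans (hφ w hw)
  have hε : 0 < w₀.re - R - c := by linarith
  have hδ : 0 < R - ρ := by linarith
  have hwR : ‖w - w₀‖ = R := mem_sphere_iff_norm.1 hw
  have h1 : w₀.re - R - c ≤ ‖w - z‖ := by
    refine le_trans ?_ (Complex.re_le_norm _)
    have h2 := (abs_le.1 (Complex.abs_re_le_norm (w - w₀))).1
    rw [hwR, Complex.sub_re] at h2
    rw [Complex.sub_re, hz]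
    linarith
  rw [norm_mul, norm_mul, norm_div, norm_one, norm_prod]
  have h3 : ∏ r, ‖(z - b r) / (w - b r)‖
      ≤ ∏ _r : Fin N, (|c| + A + 1) * (1 + z.im ^ 2) / (R - ρ) := by
    refine Finset.prod_le_prod (fun r _ => norm_nonneg _) fun r _ => ?_
    rw [norm_div]
    have h4 : R - ρ ≤ ‖w - b r‖ := by
      have h5 := mem_ball_iff_norm.1 (hb r)
      have h6 := norm_sub_le_norm_sub_add_norm_sub w (b r) w₀
      linarith
    have h7 := norm_sub_le_mul_one_add_im_sq (z := z) (B := |c|) (by rw [hz]) (hA r)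
    gcongr
  rw [Finset.prod_const, Finset.card_univ, Fintype.card_fin] at h3
  have h8 := hφ w hw
  gcongr

theorem tendsto_circleIntegral_cauchy {ι : Type*} {l : Filter ι} [l.IsCountablyGenerated] {N : ℕ}
    {w₀ : ℂ} {R ρ c A C : ℝ} (hR : 0 ≤ R) (hρR : ρ < R) (hc : c < w₀.re - R)
    {g : ι → ℂ → ℂ} {G : ℂ → ℂ} {b : ι → Fin N → ℂ} {α : Fin N → ℂ}
    (hgc : ∀ i, Continuous (g i))
    (hg : ∀ w ∈ Metric.sphere w₀ R, Tendsto (fun i => g i w) l (𝓝 (G w)))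
    (hgC : ∀ᶠ i in l, ∀ w ∈ Metric.sphere w₀ R, ‖g i w‖ ≤ C)
    (hb : ∀ r, Tendsto (fun i => b i r) l (𝓝 (α r)))
    (hbρ : ∀ᶠ i in l, ∀ r, b i r ∈ Metric.ball w₀ ρ) (hbA : ∀ᶠ i in l, ∀ r, ‖b i r‖ ≤ A)
    (hA0 : 0 ≤ A) (hα : ∀ r, α r ∈ Metric.ball w₀ R) {z : ℂ} (hz : z.re = c) :
    Tendsto (fun i => ∮ w in C(w₀, R), g i w * (1 / (w - z)) * ∏ r, (z - b i r) / (w - b i r)) l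
      (𝓝 (∮ w in C(w₀, R), G w * (1 / (w - z)) * ∏ r, (z - α r) / (w - α r))) := by
  refine intervalIntegral.tendsto_integral_filter_of_dominated_convergence
    (fun _ => R * (C * (1 / (w₀.re - R - c)) * ((|c| + A + 1) * (1 + z.im ^ 2) / (R - ρ)) ^ N))
    ?_ ?_ ?_ ?_
  · refine Eventually.of_forall fun i => Measurable.aestronglyMeasurable ?_
    have h1 : Measurable (circleMap w₀ R) := (continuous_circleMap w₀ R).measurable
    have h2 : Measurable (deriv (circleMap w₀ R)) := measurable_deriv _
    have h3 := (hgc i).measurable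
    simp only [smul_eq_mul]
    fun_prop
  · filter_upwards [hgC, hbρ, hbA] with i h1 h2 h3
    refine Eventually.of_forall fun θ _ => ?_
    rw [norm_smul, deriv_circleMap, norm_mul, Complex.norm_I, mul_one, norm_circleMap_zero,
      abs_of_nonneg hR]
    gcongr
    exact norm_cauchyKernel_le hρR hc h2 h3 hA0 h1 hz (circleMap_mem_sphere w₀ hR θ)
  · exact intervalIntegrable_const
  · refine Eventually.of_forall fun θ _ => ?_
    have hw : circleMap w₀ R θ ∈ Metric.sphere w₀ R := circleMap_mem_sphere w₀ hR θ
    refine Tendsto.const_smul (((hg _ hw).mul_const _).mul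
      (tendsto_finsetProd _ fun r _ => Tendsto.div ((hb r).const_sub z) ((hb r).const_sub _) ?_)) _
    refine sub_ne_zero.2 fun h => ?_
    have h1 := Metric.mem_ball.1 (hα r)
    rw [← h, Metric.mem_sphere.1 hw] at h1
    exact lt_irrefl _ h1

theorem continuous_circleIntegral_cauchy {N : ℕ} {w₀ : ℂ} {R c : ℝ} (hR : 0 ≤ R)
    (hc : c < w₀.re - R) {φ : ℂ → ℂ} (hφ : Continuous φ) {b : Fin N → ℂ}
    (hb : ∀ r, b r ∈ Metric.ball w₀ R) :
    Continuous fun y : ℝ => ∮ w in C(w₀, R), φ w * (1 / (w - ((c : ℂ) + y * I)))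
      * ∏ r, ((c : ℂ) + y * I - b r) / (w - b r) := by
  unfold circleIntegral
  refine intervalIntegral.continuous_parametric_intervalIntegral_of_continuous' ?_ _ _
  have h1 : ∀ θ : ℝ, circleMap w₀ R θ ∈ Metric.sphere w₀ R := circleMap_mem_sphere w₀ hR
  simp only [deriv_circleMap, smul_eq_mul, Function.uncurry_def]
  refine ((by fun_prop : Continuous fun q : ℝ × ℝ => circleMap 0 R q.2 * I)).mul
    (((by fun_prop : Continuous fun q : ℝ × ℝ => φ (circleMap w₀ R q.2)).mul
    (Continuous.div (by fun_prop) (by fun_prop) fun q h => ?_)).mul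
    (continuous_finsetProd _ fun r _ => Continuous.div (by fun_prop) (by fun_prop) fun q h => ?_))
  · have h2 := (abs_le.1 (Complex.abs_re_le_norm (circleMap w₀ R q.2 - w₀))).1
    rw [mem_sphere_iff_norm.1 (h1 q.2), sub_eq_zero.1 h] at h2
    simp at h2
    linarith
  · have h2 := Metric.mem_ball.1 (hb r)
    rw [← sub_eq_zero.1 h, Metric.mem_sphere.1 (h1 q.2)] at h2
    exact lt_irrefl _ h2

/-- Dominated convergence is applied twice, on the circle for fixed z and then on the line. The
hypothesis on h is calibrated to beat the growth of order (1+y²)^N coming from the product. -/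
theorem tendsto_lineIntegral_mul_circleIntegral {ι : Type*} {l : Filter ι}
    [l.IsCountablyGenerated] {N : ℕ} {w₀ : ℂ} {R c κ C : ℝ} (hR : 0 ≤ R) (hc : c < w₀.re - R)
    (hκ : 0 < κ) {g : ι → ℂ → ℂ} {G : ℂ → ℂ} {h : ι → ℂ → ℂ} {H : ℂ → ℂ} {b : ι → Fin N → ℂ}
    {α : Fin N → ℂ} (hgc : ∀ i, Continuous (g i))
    (hg : ∀ w ∈ Metric.sphere w₀ R, Tendsto (fun q : ι × ℂ => g q.1 q.2) (l ×ˢ 𝓝 w) (𝓝 (G w)))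
    (hb : ∀ r, Tendsto (fun i => b i r) l (𝓝 (α r))) (hα : ∀ r, α r ∈ Metric.ball w₀ R)
    (hhc : ∀ᶠ i in l, Continuous fun y : ℝ => h i ((c : ℂ) + y * I))
    (hh : ∀ z, Tendsto (fun i => h i z) l (𝓝 (H z)))
    (hhC : ∀ᶠ i in l, ∀ y : ℝ, ‖h i ((c : ℂ) + y * I)‖ * (1 + κ * y ^ 2) ^ (N + 1) ≤ C) :
    Tendsto (fun i => lineIntegral c fun z => h i z *
        ∮ w in C(w₀, R), g i w * (1 / (w - z)) * ∏ r, (z - b i r) / (w - b i r)) l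
      (𝓝 (lineIntegral c fun z => H z *
        ∮ w in C(w₀, R), G w * (1 / (w - z)) * ∏ r, (z - α r) / (w - α r))) := by
  obtain ⟨Cg, hCg⟩ := exists_eventually_norm_le_of_isCompact (isCompact_sphere w₀ R) hg
  -- An intermediate radius keeps the moving poles at distance at least R - ρ from the circle.
  obtain ⟨ρ, hρα, hρR⟩ : ∃ ρ, (∀ r, dist (α r) w₀ < ρ) ∧ ρ < R := by
    have h1 : ∀ᶠ ρ in 𝓝[<] R, ∀ r, dist (α r) w₀ < ρ := eventually_all.2 fun r =>
      eventually_nhdsWithin_of_eventually_nhds (eventually_gt_nhds (Metric.mem_ball.1 (hα r)))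
    exact (h1.and self_mem_nhdsWithin).exists
  have hbρ : ∀ᶠ i in l, ∀ r, b i r ∈ Metric.ball w₀ ρ := eventually_all.2 fun r =>
    (hb r).eventually (Metric.isOpen_ball.mem_nhds (Metric.mem_ball.2 (hρα r)))
  have hbA : ∀ᶠ i in l, ∀ r, ‖b i r‖ ≤ ‖w₀‖ + R := by
    filter_upwards [hbρ] with i hi r
    have h1 := mem_ball_iff_norm.1 (hi r)
    have h2 := norm_le_norm_add_norm_sub w₀ (b i r)
    rw [norm_sub_rev] at h2
    linarith
  have hA0 : 0 ≤ ‖w₀‖ + R := by positivity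
  set A := ‖w₀‖ + R
  have hε : 0 < w₀.re - R - c := by linarith
  have hδ : 0 < R - ρ := by linarith
  -- Chosen so that κ'(1 + y²) ≤ 1 + κy².
  set κ' := min κ 1
  have hκ' : 0 < κ' := lt_min hκ one_pos
  set D := 2 * π * R * (Cg * (1 / (w₀.re - R - c)) * ((|c| + A + 1) / (R - ρ)) ^ N)
  refine tendsto_integral_filter_of_dominated_convergence
    (fun y => C * |D| * ((κ' ^ (N + 1))⁻¹ * (1 + y ^ 2)⁻¹)) ?_ ?_ ?_ ?_
  · filter_upwards [hhc, hbρ] with i h1 h2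
    refine ((h1.mul (continuous_circleIntegral_cauchy hR hc (hgc i) fun r =>
      Metric.ball_subset_ball hρR.le (h2 r))).mul continuous_const).aestronglyMeasurable
  · filter_upwards [hhC, hCg, hbρ, hbA] with i h1 h2 h3 h4
    refine Eventually.of_forall fun y => ?_
    have hre : ((c : ℂ) + y * I).re = c := by simp
    have him : ((c : ℂ) + y * I).im = y := by simp
    have h5 := circleIntegral.norm_integral_le_of_norm_le_const hR fun w hw =>
      norm_cauchyKernel_le hρR hc h3 h4 hA0 h2 hre hw
    rw [him] at h5
    rw [norm_mul, Complex.norm_I, mul_one, norm_mul]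
    set Q := ‖∮ w in C(w₀, R), g i w * (1 / (w - ((c : ℂ) + y * I)))
      * ∏ r, ((c : ℂ) + y * I - b i r) / (w - b i r)‖
    have h6 : Q ≤ |D| * (1 + y ^ 2) ^ N := by
      refine h5.trans ?_
      have : 2 * π * R * (Cg * (1 / (w₀.re - R - c)) * ((|c| + A + 1) * (1 + y ^ 2) / (R - ρ)) ^ N)
          = D * (1 + y ^ 2) ^ N := by
        simp only [D, mul_div_right_comm, mul_pow]
        ring
      rw [this]
      gcongr
      exact le_abs_self D
    have h7 : κ' ^ (N + 1) * (1 + y ^ 2) ^ (N + 1) ≤ (1 + κ * y ^ 2) ^ (N + 1) := by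
      rw [← mul_pow]
      gcongr
      have := min_le_right κ 1
      nlinarith [mul_le_mul_of_nonneg_right (min_le_left κ 1) (sq_nonneg y)]
    set P := ‖h i ((c : ℂ) + y * I)‖
    have h8 : P * (κ' ^ (N + 1) * (1 + y ^ 2) ^ (N + 1)) ≤ C :=
      (mul_le_mul_of_nonneg_left h7 (norm_nonneg _)).trans (h1 y)
    have hpos : 0 < 1 + y ^ 2 := by positivity
    calc P * Q ≤ P * (|D| * (1 + y ^ 2) ^ N) := mul_le_mul_of_nonneg_left h6 (norm_nonneg _)
      _ = (P * (κ' ^ (N + 1) * (1 + y ^ 2) ^ (N + 1))) * (|D| * ((κ' ^ (N + 1))⁻¹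
          * (1 + y ^ 2)⁻¹)) := by
        field_simp
        ring
      _ ≤ C * (|D| * ((κ' ^ (N + 1))⁻¹ * (1 + y ^ 2)⁻¹)) :=
        mul_le_mul_of_nonneg_right h8 (by positivity)
      _ = _ := by ring
  · exact (integrable_inv_one_add_sq.const_mul _).const_mul _
  · refine Eventually.of_forall fun y => ?_
    refine ((hh _).mul (tendsto_circleIntegral_cauchy hR hρR hc hgc (fun w hw => ?_) hCg hb hbρ hbA
      hA0 hα (by simp))).mul_const _
    exact (hg w hw).comp (tendsto_id.prodMk tendsto_const_nhds)

/-! ### Asymptotics of the rounded parameters -/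

theorem tendsto_div_of_abs_sub_le {u v D : ℝ → ℝ} {a B : ℝ} (hD : Tendsto D atTop atTop)
    (h : ∀ᶠ M in atTop, |u M - v M| ≤ B) (hv : Tendsto (fun M => v M / D M) atTop (𝓝 a)) :
    Tendsto (fun M => u M / D M) atTop (𝓝 a) := by
  have h1 : Tendsto (fun M => (u M - v M) / D M) atTop (𝓝 0) := by
    refine squeeze_zero_norm' ?_ (hD.const_div_atTop B)
    filter_upwards [h, hD.eventually_gt_atTop 0] with M h2 h3
    rw [norm_div, Real.norm_eq_abs, Real.norm_of_nonneg h3.le]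
    gcongr
  have h2 := h1.add hv
  rw [zero_add] at h2
  exact h2.congr fun M => by ring

theorem eventually_lt_of_tendsto_div {f g : ℝ → ℝ} {a b : ℝ}
    (hf : Tendsto (fun M => f M / M) atTop (𝓝 a)) (hg : Tendsto (fun M => g M / M) atTop (𝓝 b))
    (hab : a < b) : ∀ᶠ M in atTop, f M < g M := by
  filter_upwards [hf.eventually_lt hg hab, eventually_gt_atTop 0] with M h1 h2
  exact (div_lt_div_iff_of_pos_right h2).1 h1

theorem tendsto_const_div_id (k : ℝ) : Tendsto (fun M : ℝ => k / M) atTop (𝓝 0) :=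
  tendsto_id.const_div_atTop k

section
variable {β : ℝ}

theorem tendsto_sqrt_mul_mul_one_sub (hβ₀ : 0 < β) (hβ₁ : β < 1) :
    Tendsto (fun M : ℝ => √(M * β * (1 - β))) atTop atTop := by
  have h : 0 < √(β * (1 - β)) := Real.sqrt_pos.2 (mul_pos hβ₀ (sub_pos.2 hβ₁))
  simp_rw [sqrt_mul_mul_one_sub hβ₀ hβ₁]
  exact Real.tendsto_sqrt_atTop.atTop_mul_const h

theorem tendsto_sqrt_div_self : Tendsto (fun M : ℝ => √M / M) atTop (𝓝 0) := by
  simp_rw [Real.sqrt_div_self']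
  exact Real.tendsto_sqrt_atTop.const_div_atTop 1

theorem tendsto_sqrt_mul_mul_one_sub_div (hβ₀ : 0 < β) (hβ₁ : β < 1) (k : ℝ) :
    Tendsto (fun M : ℝ => √(M * β * (1 - β)) * k / M) atTop (𝓝 0) := by
  have h := tendsto_sqrt_div_self.mul_const (√(β * (1 - β)) * k)
  rw [zero_mul] at h
  refine h.congr fun M => ?_
  rw [sqrt_mul_mul_one_sub hβ₀ hβ₁]
  ring

theorem eventually_abs_scaledTime_sub_le {τ : ℝ} (hτ : 0 < τ) :
    ∀ᶠ M in atTop, |(scaledTime M τ : ℝ) - M * τ| ≤ 1 := by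
  filter_upwards [eventually_ge_atTop 0] with M hM
  have h1 := Nat.floor_le (mul_nonneg hM hτ.le)
  have h2 := Nat.lt_floor_add_one (M * τ)
  rw [scaledTime, abs_le]
  constructor <;> linarith

theorem abs_scaledPosition_sub_le (β M τ ξ : ℝ) :
    |(scaledPosition β M τ ξ : ℝ) - (β * M * τ + ξ * √(β * (1 - β)) * √M)| ≤ 1 := by
  have h1 := Int.floor_le (β * M * τ + ξ * √(β * (1 - β)) * √M)
  have h2 := Int.lt_floor_add_one (β * M * τ + ξ * √(β * (1 - β)) * √M)
  rw [scaledPosition, abs_le]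
  constructor <;> linarith

theorem tendsto_scaledTime_div {τ : ℝ} (hτ : 0 < τ) :
    Tendsto (fun M => (scaledTime M τ : ℝ) / M) atTop (𝓝 τ) := by
  refine tendsto_div_of_abs_sub_le (D := fun M => M) tendsto_id
    (eventually_abs_scaledTime_sub_le hτ) ?_
  refine tendsto_const_nhds.congr' ?_
  filter_upwards [eventually_gt_atTop 0] with M hM
  field_simp

theorem tendsto_scaledPosition_div (β τ ξ : ℝ) :
    Tendsto (fun M => (scaledPosition β M τ ξ : ℝ) / M) atTop (𝓝 (β * τ)) := by
  refine tendsto_div_of_abs_sub_le (D := fun M => M) tendsto_id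
    (Eventually.of_forall fun M => abs_scaledPosition_sub_le β M τ ξ) ?_
  have h := (tendsto_sqrt_div_self.const_mul (ξ * √(β * (1 - β)))).const_add (β * τ)
  rw [mul_zero, add_zero] at h
  refine h.congr' ?_
  filter_upwards [eventually_gt_atTop 0] with M hM
  field_simp

theorem tendsto_scaledPosition_sub_div (hβ₀ : 0 < β) (hβ₁ : β < 1) (τ ξ c : ℝ) :
    Tendsto (fun M => ((scaledPosition β M τ ξ : ℝ) - √(M * β * (1 - β)) * c) / M) atTop
      (𝓝 (β * τ)) := by
  have h := (tendsto_scaledPosition_div β τ ξ).sub (tendsto_sqrt_mul_mul_one_sub_div hβ₀ hβ₁ c)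
  rw [sub_zero] at h
  exact h.congr fun M => by ring

variable {N : ℕ} {α : Fin N → ℝ}

theorem abs_scaledStart_sub_le (β : ℝ) (α : Fin N → ℝ) (M : ℝ) (r : Fin N) :
    |(scaledStart β α M r : ℝ) - α r * √(β * (1 - β)) * √M| ≤ 1 + N := by
  have h1 := Int.floor_le (α r * √(β * (1 - β)) * √M)
  have h2 := Int.lt_floor_add_one (α r * √(β * (1 - β)) * √M)
  have h3 : ((Finset.univ.filter fun j => j < r ∧ α j = α r).card : ℝ) ≤ N := by
    have h4 := Finset.card_le_univ (Finset.univ.filter fun j => j < r ∧ α j = α r)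
    rw [Fintype.card_fin] at h4
    exact_mod_cast h4
  have h5 : (0 : ℝ) ≤ ((Finset.univ.filter fun j => j < r ∧ α j = α r).card : ℝ) :=
    Nat.cast_nonneg _
  rw [scaledStart, abs_le]
  push_cast
  constructor <;> linarith

theorem tendsto_scaledStart_div_sqrt (hβ₀ : 0 < β) (hβ₁ : β < 1) (α : Fin N → ℝ) (r : Fin N) :
    Tendsto (fun M => (scaledStart β α M r : ℝ) / √(M * β * (1 - β))) atTop (𝓝 (α r)) := by
  have hS := tendsto_sqrt_mul_mul_one_sub hβ₀ hβ₁
  refine tendsto_div_of_abs_sub_le hS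
    (Eventually.of_forall fun M => abs_scaledStart_sub_le β α M r) ?_
  refine tendsto_const_nhds.congr' ?_
  filter_upwards [hS.eventually_gt_atTop 0] with M hM
  rw [eq_div_iff hM.ne', sqrt_mul_mul_one_sub hβ₀ hβ₁]
  ring

theorem tendsto_scaledStart_div (hβ₀ : 0 < β) (hβ₁ : β < 1) (α : Fin N → ℝ) (r : Fin N) :
    Tendsto (fun M => (scaledStart β α M r : ℝ) / M) atTop (𝓝 0) := by
  have h := (tendsto_scaledStart_div_sqrt hβ₀ hβ₁ α r).mul
    (tendsto_sqrt_mul_mul_one_sub_div hβ₀ hβ₁ 1)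
  rw [mul_zero] at h
  refine h.congr' ?_
  filter_upwards [(tendsto_sqrt_mul_mul_one_sub hβ₀ hβ₁).eventually_gt_atTop 0] with M hM
  field_simp

/-- Within a group of equal α the floors agree and the counts increase strictly; across groups the
limits after division by S differ. -/
theorem eventually_injective_scaledStart (hβ₀ : 0 < β) (hβ₁ : β < 1) (α : Fin N → ℝ) :
    ∀ᶠ M in atTop, Function.Injective (scaledStart β α M) := by
  have hS := tendsto_sqrt_mul_mul_one_sub hβ₀ hβ₁
  have h : ∀ i j : Fin N, i < j → ∀ᶠ M in atTop, scaledStart β α M i ≠ scaledStart β α M j := by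
    intro i j hij
    by_cases hα : α i = α j
    · refine Eventually.of_forall fun M => ne_of_lt ?_
      rw [scaledStart, scaledStart, hα]
      have : (Finset.univ.filter fun k => k < i ∧ α k = α j).card
          < (Finset.univ.filter fun k => k < j ∧ α k = α j).card := by
        refine Finset.card_lt_card (Finset.ssubset_iff_of_subset ?_ |>.2 ⟨i, ?_, ?_⟩)
        · intro k hk
          simp only [Finset.mem_filter, Finset.mem_univ, true_and] at hk ⊢
          exact ⟨hk.1.trans hij, hk.2⟩
        · simp [hij, hα]
        · simp
      omega
    · have h1 := ((tendsto_scaledStart_div_sqrt hβ₀ hβ₁ α i).sub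
        (tendsto_scaledStart_div_sqrt hβ₀ hβ₁ α j)).eventually_ne (sub_ne_zero.2 hα)
      filter_upwards [h1] with M hM h2
      rw [h2, sub_self] at hM
      exact hM rfl
  have h2 : ∀ᶠ M in atTop, ∀ i j : Fin N, i < j → scaledStart β α M i ≠ scaledStart β α M j :=
    eventually_all.2 fun i => eventually_all.2 fun j => eventually_imp_distrib_left.2 (h i j)
  filter_upwards [h2] with M hM i j hij
  rcases lt_trichotomy i j with h3 | h3 | h3
  · exact absurd hij (hM i j h3)
  · exact h3
  · exact absurd hij.symm (hM j i h3)

/-! ### Decay of the Beta weight uniform in M -/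

/-- Bernoulli's inequality with exponent k/n. It trades an exponent k growing with M for a fixed n.
-/
theorem one_add_pow_le_one_add_pow {u v : ℝ} (hu : 0 ≤ u) (hv : 0 ≤ v) {n k : ℕ} (hn : 0 < n)
    (hnk : n ≤ k) (h : n * u ≤ k * v) : (1 + u) ^ n ≤ (1 + v) ^ k := by
  have hn' : (0 : ℝ) < n := by exact_mod_cast hn
  have hq : (1 : ℝ) ≤ k / n := by
    rw [one_le_div hn']
    exact_mod_cast hnk
  have h1 := one_add_mul_self_le_rpow_one_add (s := v) (by linarith) hq
  have h2 : u ≤ k / n * v := by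
    rw [div_mul_eq_mul_div, le_div_iff₀ hn']
    linarith
  calc (1 + u) ^ n ≤ ((1 + v) ^ ((k : ℝ) / n)) ^ n := by
        gcongr
        linarith
    _ = (1 + v) ^ k := by
        rw [← Real.rpow_natCast, ← Real.rpow_mul (by linarith), div_mul_cancel₀ _ hn'.ne',
          Real.rpow_natCast]

theorem exists_scaled_betaWeight_bound (hβ₀ : 0 < β) (hβ₁ : β < 1) {τ ξ : ℝ} (hτ : 0 < τ)
    (c : ℝ) {n : ℕ} (hn : 0 < n) :
    ∃ κ C : ℝ, 0 < κ ∧ ∀ᶠ M : ℝ in atTop, ∀ y : ℝ,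
      ‖((√(M * β * (1 - β)) : ℝ) : ℂ) * betaWeight β (scaledTime M τ)
        (scaledPosition β M τ ξ - (√(M * β * (1 - β)) : ℝ) * ((c : ℂ) + y * I))‖
        * (1 + κ * y ^ 2) ^ n ≤ C := by
  have hσ : 0 < β * (1 - β) := mul_pos hβ₀ (sub_pos.2 hβ₁)
  have hn' : (0 : ℝ) < n := by exact_mod_cast hn
  have hlim := (tendsto_scaled_betaWeight (ξ := ξ) hβ₀ hβ₁ hτ (eventually_abs_scaledTime_sub_le hτ)
    (Eventually.of_forall fun M => abs_scaledPosition_sub_le β M τ ξ) c).norm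
  have hp := tendsto_scaledPosition_sub_div hβ₀ hβ₁ τ ξ c
  have hpt := eventually_lt_of_tendsto_div hp (tendsto_scaledTime_div hτ)
    (mul_lt_of_lt_one_left hτ hβ₁)
  have hpatTop : Tendsto (fun M => (scaledPosition β M τ ξ : ℝ) - √(M * β * (1 - β)) * c)
      atTop atTop := by
    refine (hp.pos_mul_atTop (mul_pos hβ₀ hτ) tendsto_id).congr' ?_
    filter_upwards [eventually_gt_atTop 0] with M hM
    simp only [id]
    field_simp
  set L := β * τ + 1
  have hL : 0 < L := by positivity
  -- C bounds the weight at the real point y = 0, where it converges; all other y are compared with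
  -- that point.
  obtain ⟨C, hC⟩ := hlim.isBoundedUnder_le
  refine ⟨β * (1 - β) / (25 * L * n), C, by positivity, ?_⟩
  filter_upwards [eventually_map.1 hC, hpt,
    hpatTop.eventually_ge_atTop n, hp.eventually (eventually_lt_nhds (lt_add_one (β * τ))),
    eventually_gt_atTop 0] with M h1 h2 h3 h4 hM y
  set S := √(M * β * (1 - β))
  have hS2 : S ^ 2 = M * β * (1 - β) := Real.sq_sqrt (by
    rw [mul_assoc]; positivity)
  set x := (scaledPosition β M τ ξ : ℝ)
  set p := x - S * c
  have hp1 : 1 ≤ p := le_trans (by exact_mod_cast hn) h3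
  have hpL : p < L * M := (div_lt_iff₀ hM).1 h4
  set s : ℂ := scaledPosition β M τ ξ - (S : ℂ) * ((c : ℂ) + y * I)
  have hre : s.re = p := by simp [s, p, x]
  have him : s.im = -(S * y) := by simp [s]
  -- Taking k comparable to p, hence to M, makes k S²/(p + 2k)² bounded below: p + 2k ≤ 5p, whence
  -- the 25, and p < LM.
  set k := ⌈p⌉₊
  have hk1 : p ≤ k := Nat.le_ceil p
  have hk2 : (k : ℝ) < p + 1 := Nat.ceil_lt_add_one (by linarith)
  have h5 := norm_betaWeight_mul_pow_le β (t := (scaledTime M τ : ℝ)) (s := s)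
    (by rw [hre]; linarith) (by rw [hre]; exact h2) k
  rw [hre, him] at h5
  have h6 : (1 + β * (1 - β) / (25 * L * n) * y ^ 2) ^ n
      ≤ (1 + (-(S * y)) ^ 2 / (p + 2 * k) ^ 2) ^ k := by
    refine one_add_pow_le_one_add_pow (by positivity) (by positivity) hn ?_ ?_
    · have : (n : ℝ) ≤ k := h3.trans hk1
      exact_mod_cast this
    · have e1 : (n : ℝ) * (β * (1 - β) / (25 * L * n) * y ^ 2)
          = β * (1 - β) * y ^ 2 / (25 * L) := by field_simp
      rw [e1, neg_sq, mul_pow, hS2, ← mul_div_assoc, div_le_div_iff₀ (by positivity) (by positivity)]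
      have h7 : (p + 2 * k) ^ 2 ≤ 25 * (p * p) := by nlinarith
      have h8 : p * p ≤ L * M * k := by
        refine mul_le_mul hpL.le hk1 (by linarith) (by positivity)
      calc β * (1 - β) * y ^ 2 * (p + 2 * k) ^ 2
          ≤ β * (1 - β) * y ^ 2 * (25 * (L * M * k)) := by
            refine mul_le_mul_of_nonneg_left (h7.trans ?_) (by positivity)
            linarith
        _ = k * (M * β * (1 - β) * y ^ 2) * (25 * L) := by ring
  have e2 : ((p : ℝ) : ℂ) = scaledPosition β M τ ξ - (S : ℂ) * c := by simp [p, x]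
  rw [e2] at h5
  rw [norm_mul]
  rw [norm_mul] at h1
  refine le_trans ?_ h1
  rw [mul_assoc]
  refine mul_le_mul_of_nonneg_left ?_ (norm_nonneg _)
  simp only [Complex.ofReal_natCast] at h5 ⊢
  exact (mul_le_mul_of_nonneg_left h6 (norm_nonneg _)).trans h5

end

/-! ### Limits of the two terms and conclusion -/

section
variable {N : ℕ} {β τ₁ ξ₁ τ₂ ξ₂ c R : ℝ} {w₀ : ℂ} {α : Fin N → ℝ}

theorem tendsto_scaled_lineIntegral (hβ₀ : 0 < β) (hβ₁ : β < 1)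
    (hτ₁ : 0 < τ₁) (hτ₂ : 0 < τ₂) (hR : 0 ≤ R) (hc : c < w₀.re - R)
    (hα : ∀ r, (α r : ℂ) ∈ Metric.ball w₀ R) :
    Tendsto (fun M : ℝ => lineIntegral c (fun z =>
        ((√(M * β * (1 - β)) : ℝ) * betaWeight β (scaledTime M τ₂)
            (scaledPosition β M τ₂ ξ₂ - (√(M * β * (1 - β)) : ℝ) * z)) *
          ∮ w in C(w₀, R), ((√(M * β * (1 - β)) : ℝ) * binomialWeight β (scaledTime M τ₁)
            (scaledPosition β M τ₁ ξ₁ - (√(M * β * (1 - β)) : ℝ) * w)) * (1 / (w - z))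
            * ∏ r, (z - scaledStart β α M r / (√(M * β * (1 - β)) : ℝ))
              / (w - scaledStart β α M r / (√(M * β * (1 - β)) : ℝ)))) atTop
      (𝓝 (1 / (√(τ₁ * τ₂) : ℝ) * lineIntegral c (fun z =>
        ∮ w in C(w₀, R),
          1 / (w - z)
            * Complex.exp (((τ₁ : ℂ) * (z - ξ₂) ^ 2 - (τ₂ : ℂ) * (w - ξ₁) ^ 2)
                / (2 * (τ₁ : ℂ) * (τ₂ : ℂ)))
            * ∏ r : Fin N, (z - α r) / (w - α r)))) := by
  obtain ⟨κ, C, hκ, hC⟩ := exists_scaled_betaWeight_bound (ξ := ξ₂) hβ₀ hβ₁ hτ₂ c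
    (Nat.succ_pos N)
  have hcont : ∀ᶠ M : ℝ in atTop, Continuous fun y : ℝ =>
      ((√(M * β * (1 - β)) : ℝ) : ℂ) * betaWeight β (scaledTime M τ₂)
        (scaledPosition β M τ₂ ξ₂ - (√(M * β * (1 - β)) : ℝ) * ((c : ℂ) + y * I)) := by
    have hp := tendsto_scaledPosition_sub_div hβ₀ hβ₁ τ₂ ξ₂ c
    have h0 : Tendsto (fun M : ℝ => (0 : ℝ) / M) atTop (𝓝 0) := tendsto_const_div_id 0
    filter_upwards [eventually_lt_of_tendsto_div h0 hp (mul_pos hβ₀ hτ₂),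
      eventually_lt_of_tendsto_div hp (tendsto_scaledTime_div hτ₂)
        (mul_lt_of_lt_one_left hτ₂ hβ₁)] with M h1 h2
    refine continuous_const.mul (continuous_iff_continuousAt.2 fun y => ?_)
    set S := √(M * β * (1 - β))
    have h3 : ContinuousAt (betaWeight β ((scaledTime M τ₂ : ℝ) : ℂ))
        (scaledPosition β M τ₂ ξ₂ - (S : ℂ) * ((c : ℂ) + y * I)) := by
      refine (differentiableAt_betaWeight β ?_ ?_).continuousAt
      · simpa using h1
      · simpa using h2
    rw [Complex.ofReal_natCast] at h3
    exact ContinuousAt.comp (f := fun y : ℝ =>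
      (scaledPosition β M τ₂ ξ₂ - (S : ℂ) * ((c : ℂ) + y * I))) h3 (by fun_prop)
  have hg := fun w : ℂ => tendsto_scaled_binomialWeight (ξ := ξ₁) hβ₀ hβ₁ hτ₁
    (eventually_abs_scaledTime_sub_le hτ₁)
    (Eventually.of_forall fun M => abs_scaledPosition_sub_le β M τ₁ ξ₁) w
  have hh := fun z : ℂ => tendsto_scaled_betaWeight (ξ := ξ₂) hβ₀ hβ₁ hτ₂
    (eventually_abs_scaledTime_sub_le hτ₂)
    (Eventually.of_forall fun M => abs_scaledPosition_sub_le β M τ₂ ξ₂) z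
  simp only [Complex.ofReal_natCast, Complex.ofReal_intCast] at hg hh
  have hmain := tendsto_lineIntegral_mul_circleIntegral
    (g := fun (M : ℝ) (w : ℂ) => ((√(M * β * (1 - β)) : ℝ) : ℂ) * binomialWeight β (scaledTime M τ₁)
            (scaledPosition β M τ₁ ξ₁ - (√(M * β * (1 - β)) : ℝ) * w))
    (h := fun (M : ℝ) (z : ℂ) => ((√(M * β * (1 - β)) : ℝ) : ℂ) * betaWeight β (scaledTime M τ₂)
            (scaledPosition β M τ₂ ξ₂ - (√(M * β * (1 - β)) : ℝ) * z))
    (b := fun M r => (scaledStart β α M r : ℂ) / ((√(M * β * (1 - β)) : ℝ) : ℂ))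
    (α := fun r => (α r : ℂ)) hR hc hκ
    (fun M => continuous_const.mul ((differentiable_binomialWeight β _).continuous.comp
      (by fun_prop))) (fun w _ => hg w) (fun r => by
        have h := (Complex.continuous_ofReal.tendsto _).comp
          (tendsto_scaledStart_div_sqrt hβ₀ hβ₁ α r)
        refine h.congr fun M => ?_
        simp) hα hcont hh hC
  refine hmain.trans (le_of_eq ?_)
  congr 1
  rw [lineIntegral, lineIntegral, ← integral_const_mul]
  congr 1
  funext y
  rw [← mul_assoc]
  congr 1
  rw [← circleIntegral.integral_const_mul, ← circleIntegral.integral_const_mul]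
  congr 1
  funext w
  set z : ℂ := (c : ℂ) + y * I
  have hτ₁c : (τ₁ : ℂ) ≠ 0 := by exact_mod_cast hτ₁.ne'
  have hτ₂c : (τ₂ : ℂ) ≠ 0 := by exact_mod_cast hτ₂.ne'
  have e1 : (τ₁ * (z - ξ₂) ^ 2 - τ₂ * (w - ξ₁) ^ 2) / (2 * (τ₁ : ℂ) * τ₂)
      = (z - ξ₂) ^ 2 / (2 * τ₂) + -((w - ξ₁) ^ 2 / (2 * τ₁)) := by
    field_simp
    ring
  -- The Stirling constants of the two weights combine into the prefactor of the Dyson kernel.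
  have e2 : ((√(2 * π) / √τ₂ : ℝ) : ℂ) * (((√(2 * π * τ₁))⁻¹ : ℝ) : ℂ)
      = 1 / ((√(τ₁ * τ₂) : ℝ) : ℂ) := by
    rw [← Complex.ofReal_mul, ← Complex.ofReal_one, ← Complex.ofReal_div]
    congr 1
    have h1 : √(2 * π) ≠ 0 := (Real.sqrt_pos.2 (by positivity)).ne'
    have h2 : √τ₁ ≠ 0 := (Real.sqrt_pos.2 hτ₁).ne'
    have h3 : √τ₂ ≠ 0 := (Real.sqrt_pos.2 hτ₂).ne'
    rw [Real.sqrt_mul' _ hτ₁.le, Real.sqrt_mul' _ hτ₂.le]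
    field_simp
  rw [← e2, e1, Complex.exp_add]
  ring

theorem tendsto_scaled_binomial_term (hβ₀ : 0 < β) (hβ₁ : β < 1) (hτ₁ : 0 < τ₁) (hτ₂ : 0 < τ₂) :
    Tendsto (fun M : ℝ => ((√(M * β * (1 - β)) : ℝ) : ℂ) *
        (if scaledPosition β M τ₂ ξ₂ ≤ scaledPosition β M τ₁ ξ₁ ∧ scaledTime M τ₂ < scaledTime M τ₁
          then -binomialWeight β ((scaledTime M τ₁ : ℝ) - scaledTime M τ₂ : ℝ)
            ((scaledPosition β M τ₁ ξ₁ : ℝ) - scaledPosition β M τ₂ ξ₂ : ℝ) else 0)) atTop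
      (𝓝 (if τ₂ < τ₁ then ((-(1 / √(2 * π * (τ₁ - τ₂))
        * Real.exp (-((ξ₁ - ξ₂) ^ 2 / (2 * (τ₁ - τ₂))))) : ℝ) : ℂ) else 0)) := by
  split_ifs with hτ
  · have hτ' : 0 < τ₁ - τ₂ := sub_pos.2 hτ
    -- Two floor errors, each at most 1, give B = 2.
    have h := tendsto_scaled_binomialWeight (τ := τ₁ - τ₂) (ξ := ξ₁ - ξ₂) (B := 2)
      (t := fun M => (scaledTime M τ₁ : ℝ) - scaledTime M τ₂)
      (x := fun M => (scaledPosition β M τ₁ ξ₁ : ℝ) - scaledPosition β M τ₂ ξ₂) hβ₀ hβ₁ hτ'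
      (by
        filter_upwards [eventually_abs_scaledTime_sub_le hτ₁,
          eventually_abs_scaledTime_sub_le hτ₂] with M h1 h2
        rw [abs_le] at *
        constructor <;> linarith)
      (Eventually.of_forall fun M => by
        have h1 := abs_scaledPosition_sub_le β M τ₁ ξ₁
        have h2 := abs_scaledPosition_sub_le β M τ₂ ξ₂
        rw [abs_le] at *
        constructor <;> linarith) 0
    have h' := (h.comp (f := fun M : ℝ => (M, (0 : ℂ)))
      (tendsto_id.prodMk tendsto_const_nhds)).neg
    have e : -((((√(2 * π * (τ₁ - τ₂)))⁻¹ : ℝ) : ℂ)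
        * Complex.exp (-((0 - ((ξ₁ - ξ₂ : ℝ) : ℂ)) ^ 2 / (2 * ((τ₁ - τ₂ : ℝ) : ℂ)))))
        = ((-(1 / √(2 * π * (τ₁ - τ₂))
        * Real.exp (-((ξ₁ - ξ₂) ^ 2 / (2 * (τ₁ - τ₂))))) : ℝ) : ℂ) := by
      push_cast
      rw [zero_sub, neg_sq, one_div]
    rw [e] at h'
    refine h'.congr' ?_
    filter_upwards [eventually_lt_of_tendsto_div (tendsto_scaledPosition_div β τ₂ ξ₂)
      (tendsto_scaledPosition_div β τ₁ ξ₁) (mul_lt_mul_of_pos_left hτ hβ₀),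
      eventually_lt_of_tendsto_div (tendsto_scaledTime_div hτ₂) (tendsto_scaledTime_div hτ₁) hτ]
      with M h1 h2
    rw [if_pos ⟨by exact_mod_cast h1.le, by exact_mod_cast h2⟩]
    simp only [Function.comp_apply, mul_zero, sub_zero, mul_neg]
  -- For τ₁ ≤ τ₂ monotonicity of the floor rules out the indicator for every M ≥ 0, including the
  -- boundary case of equal times.
  · refine tendsto_const_nhds.congr' ?_
    filter_upwards [eventually_ge_atTop 0] with M hM
    rw [if_neg, mul_zero]
    rintro ⟨-, h⟩
    exact absurd (Nat.floor_le_floor (mul_le_mul_of_nonneg_left (not_lt.1 hτ) hM)) (not_le.2 h)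

end

theorem theoremA2 {N : ℕ} (hN : 0 < N) (β : ℝ) (hβ₀ : 0 < β) (hβ₁ : β < 1)
    (α : Fin N → ℝ) (hα : Monotone α) :
    ∃ f : ℝ → ℕ → ℤ → ℝ, (∀ M t x, f M t x ≠ 0) ∧
      ∀ τ₁ ξ₁ τ₂ ξ₂ : ℝ, 0 < τ₁ → 0 < τ₂ →
      ∀ (c : ℝ) (w₀ : ℂ) (R : ℝ), c < w₀.re - R → (∀ r, (α r : ℂ) ∈ Metric.ball w₀ R) →
        Tendsto (fun M : ℝ =>
            ((f M (scaledTime M τ₁) (scaledPosition β M τ₁ ξ₁)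
              / f M (scaledTime M τ₂) (scaledPosition β M τ₂ ξ₂) : ℝ) : ℂ)
            * ((√(M * β * (1 - β)) : ℝ) : ℂ)
            * bernoulliKernel β (scaledStart β α M)
                (scaledTime M τ₁) (scaledPosition β M τ₁ ξ₁)
                (scaledTime M τ₂) (scaledPosition β M τ₂ ξ₂))
          atTop (𝓝 (dysonKernel α c w₀ R τ₁ ξ₁ τ₂ ξ₂)) := by
  refine ⟨fun _ t x => bernoulliGauge β t x, fun _ t x => bernoulliGauge_ne_zero hβ₀ hβ₁ t x, ?_⟩
  intro τ₁ ξ₁ τ₂ ξ₂ hτ₁ hτ₂ c w₀ R hc hαR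
  have hR : 0 < R := Metric.pos_of_mem_ball (hαR ⟨0, hN⟩)
  have hlim := (tendsto_scaled_binomial_term (ξ₁ := ξ₁) (ξ₂ := ξ₂) hβ₀ hβ₁ hτ₁ hτ₂).sub
    ((tendsto_scaled_lineIntegral (ξ₁ := ξ₁) (ξ₂ := ξ₂) hβ₀ hβ₁ hτ₁ hτ₂ hR.le hc hαR).const_mul
      (1 / (2 * π * I) ^ 2))
  have e : dysonKernel α c w₀ R τ₁ ξ₁ τ₂ ξ₂
      = (if τ₂ < τ₁ then ((-(1 / √(2 * π * (τ₁ - τ₂))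
        * Real.exp (-((ξ₁ - ξ₂) ^ 2 / (2 * (τ₁ - τ₂))))) : ℝ) : ℂ) else 0)
        - 1 / (2 * π * I) ^ 2 * (1 / (√(τ₁ * τ₂) : ℝ) * lineIntegral c (fun z =>
        ∮ w in C(w₀, R),
          1 / (w - z)
            * Complex.exp (((τ₁ : ℂ) * (z - ξ₂) ^ 2 - (τ₂ : ℂ) * (w - ξ₁) ^ 2)
                / (2 * (τ₁ : ℂ) * (τ₂ : ℂ)))
            * ∏ r : Fin N, (z - α r) / (w - α r))) := by
    rw [dysonKernel, ← mul_assoc, one_div_mul_one_div]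
  rw [e]
  refine hlim.congr' ?_
  have hS := tendsto_sqrt_mul_mul_one_sub hβ₀ hβ₁
  have hx₁ := tendsto_scaledPosition_div β τ₁ ξ₁
  have hx₂ := tendsto_scaledPosition_sub_div hβ₀ hβ₁ τ₂ ξ₂ c
  have ht₁ := tendsto_scaledTime_div hτ₁
  have ht₂ := tendsto_scaledTime_div hτ₂
  have ha := tendsto_scaledStart_div hβ₀ hβ₁ α
  have hneg : ∀ τ : ℝ, 0 < τ → β * τ - τ < 0 := fun τ hτ =>
    sub_neg.2 (mul_lt_of_lt_one_left hτ hβ₁)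
  have hxt₁ : Tendsto (fun M => ((scaledPosition β M τ₁ ξ₁ : ℝ) - scaledTime M τ₁) / M) atTop
      (𝓝 (β * τ₁ - τ₁)) := (hx₁.sub ht₁).congr fun M => by ring
  have hxt₂ : ∀ k : ℝ, Tendsto (fun M => ((scaledPosition β M τ₂ ξ₂ : ℝ) - scaledTime M τ₂ + k) / M)
      atTop (𝓝 (β * τ₂ - τ₂)) := fun k => by
    have h := ((tendsto_scaledPosition_div β τ₂ ξ₂).sub ht₂).add (tendsto_const_div_id k)
    rw [add_zero] at h
    exact h.congr fun M => by ring
  have hball : ∀ᶠ M in atTop, ∀ r, (scaledStart β α M r : ℂ)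
      ∈ Metric.ball ((√(M * β * (1 - β)) : ℝ) * w₀) (√(M * β * (1 - β)) * R) := by
    refine eventually_all.2 fun r => ?_
    have h1 := ((Complex.continuous_ofReal.tendsto _).comp
      (tendsto_scaledStart_div_sqrt hβ₀ hβ₁ α r)).eventually
      (Metric.isOpen_ball.mem_nhds (hαR r))
    filter_upwards [h1, hS.eventually_gt_atTop 0] with M h2 h3
    have h4 : (scaledStart β α M r : ℂ) = (√(M * β * (1 - β)) : ℝ)
        * (((scaledStart β α M r : ℝ) / √(M * β * (1 - β)) : ℝ) : ℂ) := by
      rw [← Complex.ofReal_mul, mul_div_cancel₀ _ h3.ne', Complex.ofReal_intCast]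
    rw [mem_ball_iff_norm, h4, ← mul_sub, norm_mul, Complex.norm_real, Real.norm_of_nonneg h3.le]
    exact mul_lt_mul_of_pos_left (mem_ball_iff_norm.1 h2) h3
  -- All the position inequalities follow at scale M: positions are near βτM, times near τM, and
  -- both the a_r and Sc are o(M), while 0 < β < 1.
  filter_upwards [hS.eventually_gt_atTop 0, hball, eventually_injective_scaledStart hβ₀ hβ₁ α,
    eventually_lt_of_tendsto_div (tendsto_const_div_id 0) ht₂ hτ₂,
    eventually_all.2 fun r => eventually_lt_of_tendsto_div hxt₁ (ha r) (hneg τ₁ hτ₁),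
    eventually_all.2 fun r => eventually_lt_of_tendsto_div (hxt₂ 1) (ha r) (hneg τ₂ hτ₂),
    eventually_all.2 fun r => eventually_lt_of_tendsto_div (ha r) hx₁ (mul_pos hβ₀ hτ₁),
    eventually_lt_of_tendsto_div (hxt₂ (1 / 2)) (tendsto_sqrt_mul_mul_one_sub_div hβ₀ hβ₁ c)
      (hneg τ₂ hτ₂),
    eventually_lt_of_tendsto_div (tendsto_const_div_id 0) hx₂ (mul_pos hβ₀ hτ₂)]
    with M h1 h2 h3 h4 h5 h6 h7 h8 h9
  have hcS : √(M * β * (1 - β)) * c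
      < (((√(M * β * (1 - β)) : ℝ) : ℂ) * w₀).re - √(M * β * (1 - β)) * R := by
    rw [Complex.re_ofReal_mul, ← mul_sub]
    exact mul_lt_mul_of_pos_left hc h1
  -- The limit side is unscaled to the line Re z = Sc. The kernel side, on the line x₂ - t₂ + 1/2,
  -- is then moved right to Sc, which lies in the strip of holomorphy and left of the scaled circle.
  rw [← scale_lineIntegral_contractedIntegrand β (scaledStart β α M) (scaledTime M τ₁)
    (scaledPosition β M τ₁ ξ₁) (scaledTime M τ₂) (scaledPosition β M τ₂ ξ₂) w₀ R c h1,
    mul_right_comm (Complex.ofReal _), gauge_mul_bernoulliKernel hN hβ₀ hβ₁ h3 (by exact_mod_cast h4)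
      (fun r => by exact_mod_cast (h5 r).le) (fun r => by exact_mod_cast (h6 r).le)
      (fun r => by exact_mod_cast (h7 r).le) (h8.trans hcS) h2,
    lineIntegral_contractedIntegrand_eq hN β h3 h8.le (by linarith) (by linarith) hcS h2]
  ring
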